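/- Notation. An ensemble of $n$-qubit unitaries is a Borel probability measure on $\mathcal{U}((\mathbb{C}^2)^{\otimes n})$. It is *locally scrambled* if it is invariant under $U\mapsto U(U_1\otimes\cdots\otimes U_n)$ for all $U_1,\dots,U_n\in\mathcal{U}(\mathbb{C}^2)$. An ensemble $\mathcal{U}$ is *locally scrambled up to second moments* if there is a locally scrambled ensemble $\tilde{\mathcal{U}}$ such that $\mathbb{E}_{U\sim\mathcal{U}}[U\rho U^\dagger]=\mathbb{E}_{U\sim\tilde{\mathcal{U}}}[U\rho U^\dagger]$ for all density matrices $\rho$ on $(\mathbb{C}^2)^{\otimes n}$ and $\mathbb{E}_{U\sim\mathcal{U}}[U^{\otimes 2}\rho (U^\dagger)^{\otimes 2}]=\mathbb{E}_{U\sim\tilde{\mathcal{U}}}[U^{\otimes 2}\rho (U^\dagger)^{\otimes 2}]$ for all density matrices $\rho$ on two copies of $(\mathbb{C}^2)^{\otimes n}$. An ensemble of pure $n$-qubit states belongs to $\mathbb{S}^{(2)}_{\mathrm{LS}}$ if it is the law of $U|0\rangle^{\otimes n}$, $U\sim\mathcal{U}$, for some $\mathcal{U}$ that is locally scrambled up to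 second moments. For $n$-qubit unitaries $U,V$, an ensemble $\mathcal{P}$ of pure states and states $\mathcal{D}=(|\Psi^{(1)}\rangle,\dots,|\Psi^{(N)}\rangle)$ (with outputs $U|\Psi^{(j)}\rangle$) put $$R_{\mathcal{P}}(U,V)=\tfrac14\,\mathbb{E}_{|\Psi\rangle\sim\mathcal{P}}\big\|U|\Psi\rangle\langle\Psi|U^\dagger-V|\Psi\rangle\langle\Psi|V^\dagger\big\|_1^2,\qquad C_{\mathcal{D}}(U,V)=\frac1{4N}\sum_{j=1}^N\big\|U|\Psi^{(j)}\rangle\langle\Psi^{(j)}|U^\dagger-V|\Psi^{(j)}\rangle\langle\Psi^{(j)}|V^\dagger\big\|_1^2 ,$$ where $\|\cdot\|_1$ is the trace norm. A *QNN with $T$ parameterized $k$-local gates* and parameter set $A$ assigns to each $\alpha\in A$ a circuit $V(\alpha)=W_0G_1W_1G_2W_2\cdots G_TW_T$, where each $G_i$ is a unitary acting on a set $S_i$ of at most $k$ qubits (and as the identity on the others) that depends arbitrarily on $\alpha$, and the circuit structure, consisting of the sets $S_i$ and the fixed $n$-qubit unitaries $W_i$, may depend on $\alpha$ too. Statement.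 Let $k,\kappa\ge 0$ be integers. There is a constant $c>0$ depending only on $k$ and $\kappa$ such that the following holds for all $n\ge 0$, $T\ge 2$, $N\ge1$ and $\delta\in(0,1)$. Let $\mathcal{P},\mathcal{Q}\in\mathbb{S}^{(2)}_{\mathrm{LS}}$ be ensembles of pure $n$-qubit states, let $U$ be any $n$-qubit unitary, and let $V(\cdot)$ be an $n$-qubit QNN with $T$ parameterized $k$-local gates that takes at most $T^{\kappa T}$ different circuit structures (for instance a single, fixed one, for which $\kappa=0$ suffices). Then, with probability at least $1-\delta$ over $N$ independent training states $\mathcal{D}_{\mathcal{Q}}(N)$ drawn from $\mathcal{Q}$, simultaneously for all parameter settings $\alpha\in A$ (in particular for any $\alpha_{\mathrm{opt}}$ obtained by training on the data), $$R_{\mathcal{P}}(U,V(\alpha))\le 2\,C_{\mathcal{D}_{\mathcal{Q}}(N)}(U,V(\alpha))+c\left(\sqrt{\frac{T\log T}{N}}+\sqrt{\frac{\log(1/\delta)}{N}}\right).$$ -/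

import Mathlib

open scoped Matrix Kronecker ComplexOrder
open MeasureTheory

namespace OOD

noncomputable section

/-- Labels `x ∈ {0,1}ⁿ` of the computational basis of `(ℂ²)^{⊗ n}`. -/
abbrev Bits (n : ℕ) : Type := Fin n → Fin 2

/-- Operators on `(ℂ²)^{⊗ n}`, as matrices in the computational basis. -/
abbrev Op (n : ℕ) : Type := Matrix (Bits n) (Bits n) ℂ

/-- Vectors in `(ℂ²)^{⊗ n}`, by their coordinates in the computational basis. -/
abbrev Ket (n : ℕ) : Type := Bits n → ℂ

/-- The group of `n`-qubit unitaries. -/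
abbrev UGroup (n : ℕ) : Type := ↥(Matrix.unitaryGroup (Bits n) ℂ)

instance instMeasurableSpaceUGroup (n : ℕ) : MeasurableSpace (UGroup n) := borel _

instance instBorelSpaceUGroup (n : ℕ) : BorelSpace (UGroup n) := ⟨rfl⟩

/-! ### Locally scrambled ensembles -/

/-- The matrix of `U₁ ⊗ ⋯ ⊗ Uₙ` for one-qubit operators `Uᵢ`. -/
def tensorMatrix {n : ℕ} (u : Fin n → Matrix (Fin 2) (Fin 2) ℂ) : Op n :=
  Matrix.of fun x y => ∏ i, u i (x i) (y i)

theorem tensorMatrix_mul {n : ℕ} (u v : Fin n → Matrix (Fin 2) (Fin 2) ℂ) :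
    tensorMatrix u * tensorMatrix v = tensorMatrix fun i => u i * v i := by
  ext x y
  simp only [tensorMatrix, Matrix.mul_apply, Matrix.of_apply, ← Finset.prod_mul_distrib]
  rw [Finset.prod_univ_sum]
  simp

theorem tensorMatrix_star {n : ℕ} (u : Fin n → Matrix (Fin 2) (Fin 2) ℂ) :
    star (tensorMatrix u) = tensorMatrix fun i => star (u i) := by
  ext x y
  simp [tensorMatrix, Matrix.star_apply]

theorem tensorMatrix_one {n : ℕ} :
    tensorMatrix (fun _ : Fin n => (1 : Matrix (Fin 2) (Fin 2) ℂ)) = 1 := by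
  ext x y
  simp [tensorMatrix, Matrix.one_apply, Finset.prod_ite_zero, funext_iff]

/-- The tensor product `U₁ ⊗ ⋯ ⊗ Uₙ` of one-qubit unitaries, as an `n`-qubit unitary. -/
def tensorUnitary {n : ℕ} (u : Fin n → ↥(Matrix.unitaryGroup (Fin 2) ℂ)) : UGroup n :=
  ⟨tensorMatrix fun i => (u i : Matrix (Fin 2) (Fin 2) ℂ), by
    rw [Matrix.mem_unitaryGroup_iff, tensorMatrix_star, tensorMatrix_mul, ← tensorMatrix_one]
    congr 1
    funext i
    exact Matrix.mem_unitaryGroup_iff.1 (u i).2⟩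

/-- An ensemble of `n`-qubit unitaries is locally scrambled: it is a probability measure that is
invariant under pre-processing by tensor products of one-qubit unitaries. -/
structure LocallyScrambled {n : ℕ} (𝒰 : Measure (UGroup n)) : Prop where
  isProbabilityMeasure : IsProbabilityMeasure 𝒰
  map_mul_tensor : ∀ u : Fin n → ↥(Matrix.unitaryGroup (Fin 2) ℂ),
    𝒰.map (fun U : UGroup n => U * tensorUnitary u) = 𝒰

/-- Density matrices: positive semidefinite matrices of trace one. -/
def IsDensity {ι : Type} [Fintype ι] (ρ : Matrix ι ι ℂ) : Prop :=
  ρ.PosSemidef ∧ ρ.trace = 1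

/-- An ensemble of `n`-qubit unitaries is locally scrambled up to and including complex second
moments: its complex first and second moments are those of some locally scrambled ensemble
(the matrix-valued expectations are taken entrywise). -/
structure LocallyScrambled₂ {n : ℕ} (𝒰 : Measure (UGroup n)) : Prop where
  isProbabilityMeasure : IsProbabilityMeasure 𝒰
  moments : ∃ 𝒰' : Measure (UGroup n), LocallyScrambled 𝒰' ∧
    (∀ ρ : Op n, IsDensity ρ → ∀ x y,
      ∫ U : UGroup n, ((U : Op n) * ρ * (U : Op n)ᴴ) x y ∂𝒰 =
        ∫ U : UGroup n, ((U : Op n) * ρ * (U : Op n)ᴴ) x y ∂𝒰') ∧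
    (∀ ρ : Matrix (Bits n × Bits n) (Bits n × Bits n) ℂ, IsDensity ρ → ∀ x y,
      ∫ U : UGroup n, (((U : Op n) ⊗ₖ (U : Op n)) * ρ * ((U : Op n) ⊗ₖ (U : Op n))ᴴ) x y ∂𝒰 =
        ∫ U : UGroup n, (((U : Op n) ⊗ₖ (U : Op n)) * ρ * ((U : Op n) ⊗ₖ (U : Op n))ᴴ) x y ∂𝒰')

/-- The all-zero state `|0⟩^{⊗ n}`. -/
def zeroKet (n : ℕ) : Ket n := Pi.single 0 1

/-- The ensemble `𝒰 |0⟩^{⊗ n}` of states obtained by applying unitaries drawn from `𝒰` to the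
all-zero state. -/
def stateEnsemble {n : ℕ} (𝒰 : Measure (UGroup n)) : Measure (Ket n) :=
  𝒰.map fun U : UGroup n => (U : Op n) *ᵥ zeroKet n

/-- The ensembles of pure `n`-qubit states that are locally scrambled up to and including complex
second moments. -/
def LocallyScrambledStates₂ {n : ℕ} (P : Measure (Ket n)) : Prop :=
  ∃ 𝒰 : Measure (UGroup n), LocallyScrambled₂ 𝒰 ∧ P = stateEnsemble 𝒰

/-! ### Risk and training cost -/

/-- The trace norm `‖A‖₁ = Tr √(A†A)`, i.e. the sum of the singular values of `A`. -/
def traceNorm {ι : Type} [Fintype ι] [DecidableEq ι] (A : Matrix ι ι ℂ) : ℝ :=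
  ∑ i, √((Matrix.isHermitian_conjTranspose_mul_self A).eigenvalues i)

/-- The operator `|ψ⟩⟨ψ|`. -/
def proj {n : ℕ} (ψ : Ket n) : Op n := Matrix.vecMulVec ψ (star ψ)

/-- `¼ ‖U|ψ⟩⟨ψ|U† - V|ψ⟩⟨ψ|V†‖₁²`. -/
def loss {n : ℕ} (U V : Op n) (ψ : Ket n) : ℝ :=
  1 / 4 * traceNorm (U * proj ψ * Uᴴ - V * proj ψ * Vᴴ) ^ 2

/-- The expected risk `R_P(U, V)`. -/
def risk {n : ℕ} (P : Measure (Ket n)) (U V : Op n) : ℝ :=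
  ∫ ψ, loss U V ψ ∂P

/-- The training cost `C_D(U, V)` for the training data
`D = {(|ψ⁽ʲ⁾⟩, U|ψ⁽ʲ⁾⟩) : 1 ≤ j ≤ N}`. -/
def trainingCost {n N : ℕ} (D : Fin N → Ket n) (U V : Op n) : ℝ :=
  1 / N * ∑ j, loss U V (D j)

/-! ### Quantum neural networks -/

/-- The operator `G ⊗ 1` on `n` qubits, where `G` acts on the qubits in `S` and the identity acts
on the remaining ones. -/
def onWires {n : ℕ} (S : Finset (Fin n)) (G : Matrix (S → Fin 2) (S → Fin 2) ℂ) : Op n :=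
  Matrix.of fun x y =>
    if ∀ i, i ∉ S → x i = y i then G (fun i => x i) (fun i => y i) else 0

/-- A circuit structure with `T` slots for parameterized gates, each of which acts on at most `k`
qubits. Arbitrary fixed `n`-qubit unitaries are placed before, between and after the slots. -/
structure Layout (n k T : ℕ) where
  fixed : Fin (T + 1) → UGroup n
  wires : Fin T → Finset (Fin n)
  card_wires_le : ∀ i, (wires i).card ≤ k

/-- An `n`-qubit unitary QNN with `T` parameterized `k`-local gates and parameters `α ∈ A`. The
parameters may have continuous and discrete components: every gate and also the circuit structure
may depend on them. (A gate may be the identity, so that circuits with fewer gates are included.) -/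
structure QNN (n k T : ℕ) (A : Type*) where
  layout : A → Layout n k T
  gate : ∀ (α : A) (i : Fin T), ↥(Matrix.unitaryGroup (↥((layout α).wires i) → Fin 2) ℂ)

/-- The unitary `V(α) = W₀ G₁ W₁ G₂ W₂ ⋯ G_T W_T` implemented by the QNN, where the `Wᵢ` are the
fixed unitaries and the `Gᵢ` are the parameterized gates. -/
def QNN.V {n k T : ℕ} {A : Type*} (q : QNN n k T A) (α : A) : Op n :=
  ((q.layout α).fixed 0 : Op n) *
    (List.ofFn fun i : Fin T =>
      onWires ((q.layout α).wires i) (q.gate α i : Matrix _ _ ℂ) *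
        ((q.layout α).fixed i.succ : Op n)).prod

/-- The number of circuit structures that the QNN can take. -/
def QNN.numStructures {n k T : ℕ} {A : Type*} (q : QNN n k T A) : ℕ∞ :=
  (Set.range q.layout).encard

end

end OOD

/-! The risk of an ensemble in `LocallyScrambledStates₂` depends on the second moment only, so it
may be computed with a locally scrambled ensemble of unitaries, whose output on `|0⟩^{⊗ n}` has the
law of `X φ` with `φ` a random product of one-qubit stabilizer states, independent of `X`. Expanding
the unitary `W = X† U† V X` in Pauli strings, the average of `|⟨φ|W|φ⟩|²` over `φ` weighs the
squared coefficient of a string of weight `w` by `3 ^ (-w)`, so that it lies between `|Tr W|² / 4ⁿ` and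
`1 / 3 + 2 / 3 |Tr W|² / 4ⁿ` (`avg_productExp_mem`). As `Tr W = Tr U† V`, every such risk lies
between `2 / 3` of the infidelity `1 - |Tr U† V|² / 4ⁿ` and the infidelity itself
(`LocallyScrambledStates₂.risk_mem`), whence `R_P ≤ 3 / 2 R_Q`.

The ratio `3 / 2` is smaller than the factor `2` of the claim. A bound `R_Q ≤ 4 / 3 C + error`
therefore suffices, and with this multiplicative slack a one-sided Chernoff bound
(`measureReal_pi_chernoff`) has an error of order `log (M / δ) / N` for a union over `M` circuits.
Rounding the entries of the gates to a grid of width `1 / (T N)` splits the circuits into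
`M ≤ T ^ (κ T) (2 T N + 1) ^ (2 4ᵏ T)` classes with nearly constant loss
(`QNN.exists_finite_code`), because the errors of the gates add up in operator norm. The resulting
error, of order `T log (T N) / N + log (1 / δ) / N`, is `O(√(T log T / N) + √(log (1 / δ) / N))`
whenever the two roots are at most one (`complexity_le`); no chaining is needed to remove `log N`.
If one of the roots exceeds one, the claim holds since risks are at most one. -/

namespace OOD

noncomputable section

/-! ### The loss as a fidelity -/

/-- A Hermitian matrix `A` with `A³ = μ² A` has eigenvalues in `{0, μ, -μ}`, so its trace norm is
determined by `μ` and `Tr A²`. -/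
theorem traceNorm_mul_of_cube_eq {ι : Type} [Fintype ι] [DecidableEq ι] {A : Matrix ι ι ℂ}
    (hA : A.IsHermitian) {μ : ℝ} (hμ : 0 ≤ μ) (h : A * A * A = ((μ : ℂ) ^ 2) • A) :
    traceNorm A * μ = (A * A).trace.re ∧ (μ = 0 → traceNorm A = 0) := by
  have hB := Matrix.isHermitian_conjTranspose_mul_self A
  have hBB : (Aᴴ * A) * (Aᴴ * A) = ((μ : ℂ) ^ 2) • (Aᴴ * A) := by
    rw [hA.eq, ← mul_assoc, h, Matrix.smul_mul]
  have key : ∀ i, hB.eigenvalues i = 0 ∨ hB.eigenvalues i = μ ^ 2 := by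
    intro i
    have h1 := hB.mulVec_eigenvectorBasis i
    set v : ι → ℂ := (hB.eigenvectorBasis i).ofLp with hv
    have hv0 : v ≠ 0 := by
      have := hB.eigenvectorBasis.orthonormal.ne_zero i
      intro h0
      apply this
      ext j
      exact congrFun h0 j
    have h2 : ((Aᴴ * A) * (Aᴴ * A)) *ᵥ v = (hB.eigenvalues i ^ 2) • v := by
      rw [← Matrix.mulVec_mulVec, h1, Matrix.mulVec_smul, h1, smul_smul, sq]
    rw [hBB, Matrix.smul_mulVec, h1] at h2
    have h3 : (μ ^ 2 * hB.eigenvalues i - hB.eigenvalues i ^ 2) • v = 0 := by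
      rw [sub_smul, ← h2, sub_eq_zero, mul_smul]
      ext j
      simp
    have h4 := (smul_eq_zero.1 h3).resolve_right hv0
    have h5 : hB.eigenvalues i * (hB.eigenvalues i - μ ^ 2) = 0 := by linarith
    rcases mul_eq_zero.1 h5 with h6 | h6
    · exact Or.inl h6
    · exact Or.inr (by linarith)
  constructor
  · have ht := hB.trace_eq_sum_eigenvalues
    have hAA : (A * A).trace = (Aᴴ * A).trace := by rw [hA.eq]
    rw [hAA, ht, traceNorm, Finset.sum_mul, Complex.re_sum]
    refine Finset.sum_congr rfl fun i _ => ?_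
    rcases key i with h0 | h0
    · simp [h0]
    · rw [h0, Real.sqrt_sq hμ, ← sq]
      exact (Complex.ofReal_re _).symm
  · rintro rfl
    refine Finset.sum_eq_zero fun i _ => ?_
    rcases key i with h0 | h0 <;> simp [h0]

theorem star_dotProduct_comm {ι : Type} [Fintype ι] (u v : ι → ℂ) :
    star v ⬝ᵥ u = star (star u ⬝ᵥ v) := by
  simp [dotProduct, mul_comm]

/-- The difference of two projectors `|u⟩⟨u| - |v⟩⟨v|` with `‖u‖ = ‖v‖` is traceless of rank at most
two, so its trace norm is `2 √(‖u‖⁴ - |⟨u|v⟩|²)`. -/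
theorem traceNorm_sq_vecMulVec_sub {ι : Type} [Fintype ι] [DecidableEq ι] (u v : ι → ℂ)
    (huv : star u ⬝ᵥ u = star v ⬝ᵥ v) :
    traceNorm (Matrix.vecMulVec u (star u) - Matrix.vecMulVec v (star v)) ^ 2 =
      4 * ((star u ⬝ᵥ u).re ^ 2 - ‖star u ⬝ᵥ v‖ ^ 2) := by
  set s : ℝ := (star u ⬝ᵥ u).re with hs
  set g : ℂ := star u ⬝ᵥ v with hg
  have hself : ∀ w : ι → ℂ, star w ⬝ᵥ w = (((∑ i, ‖w i‖ ^ 2 : ℝ)) : ℂ) := by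
    intro w
    simp [dotProduct, Complex.conj_mul']
  have hsu : star u ⬝ᵥ u = (s : ℂ) := by
    rw [hs, hself u, Complex.ofReal_re]
  have hsv : star v ⬝ᵥ v = (s : ℂ) := by rw [← huv, hsu]
  have hvu : star v ⬝ᵥ u = star g := star_dotProduct_comm u v
  have hgg : g * star g = ((‖g‖ ^ 2 : ℝ) : ℂ) := by
    simp [Complex.mul_conj']
  have hgg' : star g * g = ((‖g‖ ^ 2 : ℝ) : ℂ) := by rw [mul_comm, hgg]
  -- Cauchy-Schwarz
  have hcs : ‖g‖ ^ 2 ≤ s ^ 2 := by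
    have h1 := norm_inner_le_norm (𝕜 := ℂ) (WithLp.toLp 2 u) (WithLp.toLp 2 v)
    have h2 : inner ℂ (WithLp.toLp 2 u) (WithLp.toLp 2 v) = g := by
      rw [EuclideanSpace.inner_eq_star_dotProduct, hg, dotProduct_comm]
    have h3 : ∀ w : ι → ℂ, star w ⬝ᵥ w = (s : ℂ) → ‖WithLp.toLp 2 w‖ ^ 2 = s := by
      intro w hw
      rw [EuclideanSpace.norm_sq_eq]
      rw [hself] at hw
      exact_mod_cast hw
    rw [h2] at h1
    calc ‖g‖ ^ 2 ≤ (‖WithLp.toLp 2 u‖ * ‖WithLp.toLp 2 v‖) ^ 2 := by gcongr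
      _ = s ^ 2 := by rw [mul_pow, h3 u hsu, h3 v hsv, sq]
  set P := Matrix.vecMulVec u (star u) with hP
  set R := Matrix.vecMulVec v (star v) with hR
  have hPP : P * P = (s : ℂ) • P := by
    rw [hP, Matrix.vecMulVec_mul_vecMulVec, hsu, Matrix.vecMulVec_smul]
  have hRR : R * R = (s : ℂ) • R := by
    rw [hR, Matrix.vecMulVec_mul_vecMulVec, hsv, Matrix.vecMulVec_smul]
  have hPRP : P * R * P = ((‖g‖ ^ 2 : ℝ) : ℂ) • P := by
    rw [hP, hR, Matrix.vecMulVec_mul_vecMulVec, Matrix.vecMulVec_smul, Matrix.smul_mul,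
      Matrix.vecMulVec_mul_vecMulVec, Matrix.vecMulVec_smul, smul_smul, ← hg, hvu, hgg]
  have hRPR : R * P * R = ((‖g‖ ^ 2 : ℝ) : ℂ) • R := by
    rw [hP, hR, Matrix.vecMulVec_mul_vecMulVec, Matrix.vecMulVec_smul, Matrix.smul_mul,
      Matrix.vecMulVec_mul_vecMulVec, Matrix.vecMulVec_smul, smul_smul, ← hg, hvu, hgg']
  have hherm : (P - R).IsHermitian := by
    refine Matrix.IsHermitian.sub ?_ ?_
    · rw [Matrix.IsHermitian, hP, Matrix.conjTranspose_vecMulVec, star_star]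
    · rw [Matrix.IsHermitian, hR, Matrix.conjTranspose_vecMulVec, star_star]
  set μ : ℝ := √(s ^ 2 - ‖g‖ ^ 2) with hμ
  have hμ2 : μ ^ 2 = s ^ 2 - ‖g‖ ^ 2 := Real.sq_sqrt (by linarith)
  have hμ2' : (μ : ℂ) ^ 2 = (s : ℂ) * s - ((‖g‖ ^ 2 : ℝ) : ℂ) := by
    rw [← Complex.ofReal_pow, hμ2]; push_cast; ring
  have hcube : (P - R) * (P - R) * (P - R) = ((μ : ℂ) ^ 2) • (P - R) := by
    have e : (P - R) * (P - R) * (P - R) = P * P * P - (P * P) * R - P * R * P + P * (R * R)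
        - R * (P * P) + R * P * R + (R * R) * P - R * R * R := by noncomm_ring
    rw [e, hPRP, hRPR, hPP, hRR, Matrix.smul_mul, hPP, Matrix.smul_mul, Matrix.mul_smul,
      Matrix.mul_smul, Matrix.smul_mul, Matrix.smul_mul, hRR, hμ2']
    module
  have htr : ((P - R) * (P - R)).trace.re = 2 * μ ^ 2 := by
    have e : (P - R) * (P - R) = P * P - P * R - R * P + R * R := by noncomm_ring
    have h1 : P.trace = s := by rw [hP, Matrix.trace_vecMulVec, dotProduct_comm, hsu]
    have h2 : R.trace = s := by rw [hR, Matrix.trace_vecMulVec, dotProduct_comm, hsv]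
    have h3 : (P * R).trace = ((‖g‖ ^ 2 : ℝ) : ℂ) := by
      rw [hP, hR, Matrix.vecMulVec_mul_vecMulVec, Matrix.vecMulVec_smul, Matrix.trace_smul,
        Matrix.trace_vecMulVec, dotProduct_comm u, hvu, ← hg, smul_eq_mul, hgg]
    rw [e, hPP, hRR, Matrix.trace_add, Matrix.trace_sub, Matrix.trace_sub,
      Matrix.trace_mul_comm R P, h3, Matrix.trace_smul, Matrix.trace_smul, h1, h2, smul_eq_mul,
      ← Complex.ofReal_mul, ← Complex.ofReal_sub, ← Complex.ofReal_sub, ← Complex.ofReal_add,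
      Complex.ofReal_re, hμ2]
    ring
  obtain ⟨h1, h0⟩ := traceNorm_mul_of_cube_eq hherm (Real.sqrt_nonneg _) hcube
  rw [← hμ, htr] at h1
  rw [← hμ2]
  rcases eq_or_ne μ 0 with h | h
  · rw [h0 h, h]; ring
  · have : traceNorm (P - R) = 2 * μ := by
      apply mul_right_cancel₀ h
      rw [h1]; ring
    rw [this]; ring

theorem conj_proj {n : ℕ} (U : Op n) (ψ : Ket n) :
    U * proj ψ * Uᴴ = Matrix.vecMulVec (U *ᵥ ψ) (star (U *ᵥ ψ)) := by
  rw [proj, Matrix.mul_vecMulVec, Matrix.vecMulVec_mul, Matrix.star_mulVec]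

theorem star_mulVec_dotProduct_mulVec {n : ℕ} (U V : Op n) (ψ : Ket n) :
    star (U *ᵥ ψ) ⬝ᵥ (V *ᵥ ψ) = star ψ ⬝ᵥ ((Uᴴ * V) *ᵥ ψ) := by
  rw [Matrix.star_mulVec, ← Matrix.dotProduct_mulVec, Matrix.mulVec_mulVec]

/-- For unitaries the loss is one minus the fidelity of the two output states (here for a possibly
unnormalized input vector). -/
theorem loss_eq {n : ℕ} {U V : Op n} (hU : Uᴴ * U = 1) (hV : Vᴴ * V = 1) (ψ : Ket n) :
    loss U V ψ = (star ψ ⬝ᵥ ψ).re ^ 2 - ‖star ψ ⬝ᵥ ((Uᴴ * V) *ᵥ ψ)‖ ^ 2 := by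
  have h1 : star (U *ᵥ ψ) ⬝ᵥ (U *ᵥ ψ) = star ψ ⬝ᵥ ψ := by
    rw [star_mulVec_dotProduct_mulVec, hU, Matrix.one_mulVec]
  have h2 : star (V *ᵥ ψ) ⬝ᵥ (V *ᵥ ψ) = star ψ ⬝ᵥ ψ := by
    rw [star_mulVec_dotProduct_mulVec, hV, Matrix.one_mulVec]
  rw [loss, conj_proj, conj_proj, traceNorm_sq_vecMulVec_sub _ _ (h1.trans h2.symm), h1,
    star_mulVec_dotProduct_mulVec]
  ring

theorem loss_nonneg {n : ℕ} (U V : Op n) (ψ : Ket n) : 0 ≤ loss U V ψ := by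
  unfold loss; positivity

theorem loss_le_one {n : ℕ} {U V : Op n} (hU : Uᴴ * U = 1) (hV : Vᴴ * V = 1) {ψ : Ket n}
    (hψ : star ψ ⬝ᵥ ψ = 1) : loss U V ψ ≤ 1 := by
  rw [loss_eq hU hV, hψ]
  simp

theorem continuous_loss {n : ℕ} {U V : Op n} (hU : Uᴴ * U = 1) (hV : Vᴴ * V = 1) :
    Continuous (loss U V) := by
  have : loss U V = fun ψ : Ket n =>
      (star ψ ⬝ᵥ ψ).re ^ 2 - ‖star ψ ⬝ᵥ ((Uᴴ * V) *ᵥ ψ)‖ ^ 2 := funext (loss_eq hU hV)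
  rw [this]
  simp only [dotProduct, Matrix.mulVec]
  fun_prop

/-! ### Pauli expansion and averages over stabilizer product states -/

/-- The Pauli matrices `1, X, Y, Z`. -/
def pauli : Fin 4 → Matrix (Fin 2) (Fin 2) ℂ :=
  ![!![1, 0; 0, 1], !![0, 1; 1, 0], !![0, -Complex.I; Complex.I, 0], !![1, 0; 0, -1]]

/-- Six one-qubit unitaries that map `|0⟩` to the six eigenstates of the Pauli matrices. They are
`K` and `K X` for `K ∈ {1, C, C†}`, where `C` is the Clifford unitary of order three (up to a phase)
that permutes the Pauli axes cyclically; this choice has Gaussian rational entries. -/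
def stab : Fin 6 → Matrix (Fin 2) (Fin 2) ℂ :=
  ![!![1, 0; 0, 1], !![0, 1; 1, 0],
    (1 / 2 : ℂ) • !![1 - Complex.I, -1 - Complex.I; 1 - Complex.I, 1 + Complex.I],
    (1 / 2 : ℂ) • !![-1 - Complex.I, 1 - Complex.I; 1 + Complex.I, 1 - Complex.I],
    (1 / 2 : ℂ) • !![1 + Complex.I, 1 + Complex.I; -1 + Complex.I, 1 - Complex.I],
    (1 / 2 : ℂ) • !![1 + Complex.I, 1 + Complex.I; 1 - Complex.I, -1 + Complex.I]]

theorem stab_mem (j : Fin 6) : stab j ∈ Matrix.unitaryGroup (Fin 2) ℂ := by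
  rw [Matrix.mem_unitaryGroup_iff]
  fin_cases j <;> ext a b <;> fin_cases a <;> fin_cases b <;>
    simp [stab, Matrix.mul_apply, Fin.sum_univ_two, Complex.ext_iff] <;> norm_num

/-- The expectation of the Pauli matrix `p` in the state `stab j |0⟩`. -/
def stabExp (j : Fin 6) (p : Fin 4) : ℂ := (star (stab j) * pauli p * stab j) 0 0

theorem stabExp_eq (j : Fin 6) (p : Fin 4) : stabExp j p =
    (![![1, 0, 0, 1], ![1, 0, 0, -1], ![1, 1, 0, 0], ![1, -1, 0, 0], ![1, 0, 1, 0],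
      ![1, 0, -1, 0]] : Matrix (Fin 6) (Fin 4) ℂ) j p := by
  fin_cases j <;> fin_cases p <;>
    simp [stabExp, stab, pauli, Matrix.mul_apply, Fin.sum_univ_two, Complex.ext_iff] <;> norm_num


theorem sum_stabExp_mul (p q : Fin 4) : ∑ j, stabExp j p * star (stabExp j q) =
    if p = q then (if p = 0 then 6 else 2) else 0 := by
  simp only [stabExp_eq]
  fin_cases p <;> fin_cases q <;> simp [Fin.sum_univ_succ] <;> norm_num

theorem sum_pauli_mul (a b c d : Fin 2) : ∑ p, star (pauli p a b) * pauli p c d =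
    if a = c ∧ b = d then 2 else 0 := by
  fin_cases a <;> fin_cases b <;> fin_cases c <;> fin_cases d <;>
    simp [pauli, Fin.sum_univ_succ] <;> norm_num

/-- Pauli strings. -/
def pauliString {n : ℕ} (p : Fin n → Fin 4) : Op n := tensorMatrix fun i => pauli (p i)

/-- The coefficients of an operator in the basis of the Pauli strings. -/
def pauliCoeff {n : ℕ} (W : Op n) (p : Fin n → Fin 4) : ℂ :=
  (2 ^ n)⁻¹ * ∑ a, ∑ b, star (pauliString p a b) * W a b

theorem sum_pauliString_mul {n : ℕ} (a b c d : Bits n) :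
    ∑ p, star (pauliString p a b) * pauliString p c d = if a = c ∧ b = d then 2 ^ n else 0 := by
  have h : ∀ p : Fin n → Fin 4, star (pauliString p a b) * pauliString p c d =
      ∏ i, star (pauli (p i) (a i) (b i)) * pauli (p i) (c i) (d i) := by
    intro p
    simp [pauliString, tensorMatrix, Finset.prod_mul_distrib]
  simp_rw [h]
  rw [← Fintype.piFinset_univ, ← Finset.prod_univ_sum (fun _ => Finset.univ)
    fun i j => star (pauli j (a i) (b i)) * pauli j (c i) (d i)]
  simp_rw [sum_pauli_mul]
  rw [Finset.prod_ite_zero]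
  simp [funext_iff, forall_and]

theorem sum_pauliCoeff_smul {n : ℕ} (W : Op n) : ∑ p, pauliCoeff W p • pauliString p = W := by
  ext c d
  simp only [Matrix.sum_apply, Matrix.smul_apply, smul_eq_mul, pauliCoeff]
  simp_rw [mul_assoc, ← Finset.mul_sum, Finset.sum_mul]
  rw [Finset.sum_comm]
  simp_rw [Finset.sum_comm (s := (Finset.univ : Finset (Fin n → Fin 4)))]
  have : ∀ a b, ∑ p, star (pauliString p a b) * W a b * pauliString p c d =
      W a b * if a = c ∧ b = d then 2 ^ n else 0 := by
    intro a b
    rw [← sum_pauliString_mul, Finset.mul_sum]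
    exact Finset.sum_congr rfl fun p _ => by ring
  simp_rw [this]
  simp only [ite_and, mul_ite, mul_zero, Finset.sum_ite_irrel, Finset.sum_const_zero,
    Finset.sum_ite_eq', Finset.mem_univ, if_true]
  field_simp

/-- Parseval's identity for the Pauli strings. -/
theorem sum_norm_pauliCoeff_sq {n : ℕ} {W : Op n} (hW : Wᴴ * W = 1) :
    ∑ p, ‖pauliCoeff W p‖ ^ 2 = 1 := by
  have h1 : ∀ p, ((‖pauliCoeff W p‖ ^ 2 : ℝ) : ℂ) =
      (2 ^ n)⁻¹ * ∑ a, ∑ b, star (W a b) * (pauliCoeff W p * pauliString p a b) := by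
    intro p
    have : ((‖pauliCoeff W p‖ ^ 2 : ℝ) : ℂ) = star (pauliCoeff W p) * pauliCoeff W p := by
      simp [Complex.conj_mul']
    rw [this]
    conv_lhs => arg 1; rw [pauliCoeff]
    rw [star_mul', star_sum]
    simp_rw [star_sum, star_mul', star_star]
    rw [mul_assoc, Finset.sum_mul]
    simp_rw [Finset.sum_mul]
    congr 1
    · simp
    · exact Finset.sum_congr rfl fun a _ => Finset.sum_congr rfl fun b _ => by ring
  have h2 : ((∑ p, ‖pauliCoeff W p‖ ^ 2 : ℝ) : ℂ) = 1 := by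
    rw [Complex.ofReal_sum]
    simp_rw [h1]
    rw [← Finset.mul_sum, Finset.sum_comm]
    simp_rw [Finset.sum_comm (s := (Finset.univ : Finset (Fin n → Fin 4))), ← Finset.mul_sum]
    have h3 : ∀ a b, ∑ p, pauliCoeff W p * pauliString p a b = W a b := by
      intro a b
      conv_rhs => rw [← sum_pauliCoeff_smul W]
      simp [Matrix.sum_apply]
    simp_rw [h3]
    have h4 : ∑ a, ∑ b, star (W a b) * W a b = (Wᴴ * W).trace := by
      rw [Finset.sum_comm]
      simp [Matrix.trace, Matrix.mul_apply]
    rw [h4, hW, Matrix.trace_one]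
    simp
  exact_mod_cast h2

theorem pauliCoeff_zero {n : ℕ} (W : Op n) : pauliCoeff W 0 = (2 ^ n)⁻¹ * W.trace := by
  have h : pauliString (0 : Fin n → Fin 4) = 1 := by
    rw [pauliString, ← tensorMatrix_one]
    congr 1
    funext i
    ext a b
    fin_cases a <;> fin_cases b <;> simp [pauli]
  rw [pauliCoeff, h]
  simp [Matrix.one_apply, Matrix.trace]

/-- The expectation of `W` in the product state `⨂ᵢ stab (u i) |0⟩`. -/
def productExp {n : ℕ} (W : Op n) (u : Fin n → Fin 6) : ℂ :=
  (star (tensorMatrix fun i => stab (u i)) * W * tensorMatrix fun i => stab (u i)) 0 0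

theorem productExp_eq {n : ℕ} (W : Op n) (u : Fin n → Fin 6) :
    productExp W u = ∑ p, pauliCoeff W p * ∏ i, stabExp (u i) (p i) := by
  conv_lhs => rw [← sum_pauliCoeff_smul W]
  rw [productExp, Finset.mul_sum, Finset.sum_mul, Matrix.sum_apply]
  refine Finset.sum_congr rfl fun p _ => ?_
  rw [Matrix.mul_smul, Matrix.smul_mul, pauliString, tensorMatrix_star, tensorMatrix_mul,
    tensorMatrix_mul]
  rfl

/-- The eigenstates of the Pauli matrices form a projective 2-design, which is why the cross terms
of different Pauli strings average to zero. -/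
theorem sum_norm_productExp_sq {n : ℕ} (W : Op n) :
    ∑ u, ‖productExp W u‖ ^ 2 =
      ∑ p, ‖pauliCoeff W p‖ ^ 2 * ∏ i, (if p i = 0 then 6 else 2) := by
  have h1 : ∀ z : ℂ, ((‖z‖ ^ 2 : ℝ) : ℂ) = z * star z := fun z => by simp [Complex.mul_conj']
  have h2 : ((∑ u, ‖productExp W u‖ ^ 2 : ℝ) : ℂ) =
      ((∑ p, ‖pauliCoeff W p‖ ^ 2 * ∏ i, (if p i = 0 then 6 else 2) : ℝ) : ℂ) := by
    rw [Complex.ofReal_sum, Complex.ofReal_sum]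
    simp_rw [h1, productExp_eq, star_sum, Finset.sum_mul_sum]
    rw [Finset.sum_comm]
    refine Finset.sum_congr rfl fun p _ => ?_
    rw [Finset.sum_comm]
    have h3 : ∀ q, ∑ u : Fin n → Fin 6, pauliCoeff W p * (∏ i, stabExp (u i) (p i)) *
        star (pauliCoeff W q * ∏ i, stabExp (u i) (q i)) =
        if p = q then pauliCoeff W p * star (pauliCoeff W q) * ∏ i, (if p i = 0 then 6 else 2)
          else 0 := by
      intro q
      have h4 : ∀ u : Fin n → Fin 6, pauliCoeff W p * (∏ i, stabExp (u i) (p i)) *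
          star (pauliCoeff W q * ∏ i, stabExp (u i) (q i)) =
          pauliCoeff W p * star (pauliCoeff W q) *
            ∏ i, stabExp (u i) (p i) * star (stabExp (u i) (q i)) := by
        intro u
        rw [star_mul', star_prod, Finset.prod_mul_distrib]
        ring
      simp_rw [h4]
      rw [← Finset.mul_sum, ← Fintype.piFinset_univ, ← Finset.prod_univ_sum (fun _ => Finset.univ)
        fun i j => stabExp j (p i) * star (stabExp j (q i))]
      simp_rw [sum_stabExp_mul]
      rw [Finset.prod_ite_zero]
      simp [funext_iff]
    simp_rw [h3]
    rw [Finset.sum_ite_eq, if_pos (Finset.mem_univ _), ← h1]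
    push_cast
    congr 1
    refine Finset.prod_congr rfl fun i _ => ?_
    split_ifs <;> simp
  exact_mod_cast h2

/-- A nontrivial Pauli string contributes at most `1 / 3` of its weight to the average over product
states; the trivial one contributes all of it. -/
theorem avg_productExp_mem {n : ℕ} {W : Op n} (hW : Wᴴ * W = 1) :
    ‖W.trace‖ ^ 2 / 4 ^ n ≤ (6 ^ n)⁻¹ * ∑ u, ‖productExp W u‖ ^ 2 ∧
    (6 ^ n)⁻¹ * ∑ u, ‖productExp W u‖ ^ 2 ≤ 1 / 3 + 2 / 3 * (‖W.trace‖ ^ 2 / 4 ^ n) := by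
  have h0 : ‖W.trace‖ ^ 2 / 4 ^ n = ‖pauliCoeff W 0‖ ^ 2 := by
    have h4 : (4 : ℝ) ^ n = (2 ^ n) ^ 2 := by
      rw [← pow_mul, mul_comm, pow_mul]
      norm_num
    rw [pauliCoeff_zero, norm_mul, norm_inv, norm_pow, Complex.norm_ofNat, h4, mul_pow, inv_pow,
      div_eq_inv_mul]
  have hp0 : ∏ i : Fin n, (if (0 : Fin n → Fin 4) i = 0 then (6 : ℝ) else 2) = 6 ^ n := by simp
  have h6 : (0 : ℝ) < 6 ^ n := by positivity
  have hs := sum_norm_pauliCoeff_sq hW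
  rw [h0, sum_norm_productExp_sq]
  rw [← Finset.add_sum_erase _ _ (Finset.mem_univ (0 : Fin n → Fin 4))] at hs ⊢
  rw [hp0]
  constructor
  · rw [inv_mul_eq_div, le_div_iff₀ h6]
    have : 0 ≤ ∑ p ∈ Finset.univ.erase (0 : Fin n → Fin 4),
        ‖pauliCoeff W p‖ ^ 2 * ∏ i, (if p i = 0 then (6 : ℝ) else 2) :=
      Finset.sum_nonneg fun p _ => mul_nonneg (by positivity)
        (Finset.prod_nonneg fun i _ => by split_ifs <;> norm_num)
    linarith
  · have hle : ∑ p ∈ Finset.univ.erase (0 : Fin n → Fin 4),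
        ‖pauliCoeff W p‖ ^ 2 * ∏ i, (if p i = 0 then (6 : ℝ) else 2) ≤
        ∑ p ∈ Finset.univ.erase (0 : Fin n → Fin 4), ‖pauliCoeff W p‖ ^ 2 * (6 ^ n / 3) := by
      refine Finset.sum_le_sum fun p hp => mul_le_mul_of_nonneg_left ?_ (by positivity)
      obtain ⟨i, hi⟩ : ∃ i, p i ≠ 0 := by
        by_contra! hcon
        exact (Finset.mem_erase.1 hp).1 (funext hcon)
      have hn : 6 * (6 : ℝ) ^ (n - 1) = 6 ^ n := by
        rw [← pow_succ', Nat.sub_add_cancel (Fin.pos i)]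
      rw [← Finset.mul_prod_erase _ _ (Finset.mem_univ i), if_neg hi, ← hn]
      have : ∏ j ∈ Finset.univ.erase i, (if p j = 0 then (6 : ℝ) else 2) ≤ 6 ^ (n - 1) := by
        calc _ ≤ ∏ j ∈ Finset.univ.erase i, (6 : ℝ) :=
              Finset.prod_le_prod (fun j _ => by split_ifs <;> norm_num)
                (fun j _ => by split_ifs <;> norm_num)
          _ = 6 ^ (n - 1) := by simp
      linarith
    rw [← Finset.sum_mul] at hle
    rw [inv_mul_eq_div, div_le_iff₀ h6]
    nlinarith

/-! ### Risks of locally scrambled ensembles -/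

theorem continuous_coe_apply {n : ℕ} (x y : Bits n) :
    Continuous fun U : UGroup n => (U : Op n) x y :=
  (continuous_subtype_val : Continuous fun U : UGroup n => (U : Op n)).matrix_elem x y

theorem conjTranspose_mul_self {n : ℕ} (U : UGroup n) : (U : Op n)ᴴ * (U : Op n) = 1 :=
  Matrix.mem_unitaryGroup_iff'.1 U.2

/-- The overlap `|⟨0|U† W U|0⟩|²`. -/
def overlap {n : ℕ} (W : Op n) (U : UGroup n) : ℝ :=
  ‖((U : Op n)ᴴ * W * (U : Op n)) 0 0‖ ^ 2

/-- The operator `U^{⊗2} ρ (U†)^{⊗2}`. -/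
def doubled {n : ℕ} (U : UGroup n) (ρ : Matrix (Bits n × Bits n) (Bits n × Bits n) ℂ) :
    Matrix (Bits n × Bits n) (Bits n × Bits n) ℂ :=
  ((U : Op n) ⊗ₖ (U : Op n)) * ρ * ((U : Op n) ⊗ₖ (U : Op n))ᴴ

/-- The density matrix of two copies of `|0⟩^{⊗ n}`. -/
def zeroPair (n : ℕ) : Matrix (Bits n × Bits n) (Bits n × Bits n) ℂ := Matrix.single (0, 0) (0, 0) 1

/-- The overlap is a linear functional of `U^{⊗2} |00⟩⟨00| (U†)^{⊗2}`. -/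
theorem overlap_eq {n : ℕ} (W : Op n) (U : UGroup n) : (overlap W U : ℂ) =
    ∑ a, ∑ b, ∑ c, ∑ d, W a b * star (W c d) *
      doubled U (zeroPair n) (b, c) (a, d) := by
  have h1 : ((U : Op n)ᴴ * W * (U : Op n)) 0 0 =
      ∑ a, ∑ b, W a b * (star ((U : Op n) a 0) * (U : Op n) b 0) := by
    rw [Matrix.mul_assoc, Matrix.mul_apply]
    refine Finset.sum_congr rfl fun a _ => ?_
    rw [Matrix.mul_apply, Finset.mul_sum]
    refine Finset.sum_congr rfl fun b _ => ?_
    rw [Matrix.conjTranspose_apply]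
    ring
  have h2 : ∀ x y : Bits n × Bits n, doubled U (zeroPair n) x y =
      (U : Op n) x.1 0 * (U : Op n) x.2 0 *
        (star ((U : Op n) y.1 0) * star ((U : Op n) y.2 0)) := by
    intro x y
    rw [doubled, zeroPair, Matrix.mul_apply, Finset.sum_eq_single (0, 0)]
    · rw [Matrix.mul_single_apply_same]
      simp
    · intro z _ hz
      rw [Matrix.mul_single_apply_of_ne _ _ _ _ _ hz, zero_mul]
    · simp
  have h3 : (overlap W U : ℂ) = ((U : Op n)ᴴ * W * (U : Op n)) 0 0 *
      star (((U : Op n)ᴴ * W * (U : Op n)) 0 0) := by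
    rw [overlap]
    simp [Complex.mul_conj']
  rw [h3, h1, star_sum, Finset.sum_mul]
  refine Finset.sum_congr rfl fun a _ => ?_
  rw [Finset.sum_mul]
  refine Finset.sum_congr rfl fun b _ => ?_
  rw [Finset.mul_sum]
  refine Finset.sum_congr rfl fun c _ => ?_
  rw [star_sum, Finset.mul_sum]
  refine Finset.sum_congr rfl fun d _ => ?_
  rw [h2]
  simp only [star_mul', star_star]
  ring

theorem continuous_overlap {n : ℕ} (W : Op n) : Continuous (overlap W) := by
  have h : Continuous fun U : UGroup n => ((U : Op n)ᴴ * W * (U : Op n)) :=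
    ((continuous_subtype_val.matrix_conjTranspose).matrix_mul continuous_const).matrix_mul
      continuous_subtype_val
  exact ((h.matrix_elem 0 0).norm).pow 2

instance compactSpace_uGroup (n : ℕ) : CompactSpace (UGroup n) := by
  have hK : IsCompact (Set.univ.pi fun _ : Bits n => Set.univ.pi fun _ : Bits n =>
      Metric.closedBall (0 : ℂ) 1) :=
    isCompact_univ_pi fun _ => isCompact_univ_pi fun _ => isCompact_closedBall 0 1
  have hcl : IsClosed {M : Op n | M * star M = 1} :=
    isClosed_eq (continuous_id.mul continuous_star) continuous_const
  have hset : ((Matrix.unitaryGroup (Bits n) ℂ : Submonoid (Op n)) : Set (Op n)) =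
      {M : Op n | M * star M = 1} := Set.ext fun M => Matrix.mem_unitaryGroup_iff
  refine isCompact_iff_compactSpace.1 (IsCompact.of_isClosed_subset hK (hset ▸ hcl) ?_)
  intro M hM x _ y _
  rw [mem_closedBall_zero_iff]
  exact entry_norm_bound_of_unitary hM x y

theorem integrable_of_continuous {n : ℕ} {E : Type*} [NormedAddCommGroup E]
    [SecondCountableTopology E] (𝒰 : Measure (UGroup n)) [IsProbabilityMeasure 𝒰]
    {f : UGroup n → E} (hf : Continuous f) : Integrable f 𝒰 := by
  borelize E
  obtain ⟨C, hC⟩ := (isCompact_univ (X := UGroup n)).exists_bound_of_continuousOn hf.continuousOn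
  exact Integrable.of_bound hf.measurable.aestronglyMeasurable C
    (Filter.Eventually.of_forall fun U => hC U (Set.mem_univ _))

/-- Only the second moment of the ensemble enters the average overlap. -/
theorem integral_overlap_congr {n : ℕ} {𝒰 𝒰' : Measure (UGroup n)} [IsProbabilityMeasure 𝒰]
    [IsProbabilityMeasure 𝒰'] (W : Op n)
    (h : ∀ ρ : Matrix (Bits n × Bits n) (Bits n × Bits n) ℂ, IsDensity ρ → ∀ x y,
      ∫ U : UGroup n, doubled U ρ x y ∂𝒰 = ∫ U : UGroup n, doubled U ρ x y ∂𝒰') :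
    ∫ U, overlap W U ∂𝒰 = ∫ U, overlap W U ∂𝒰' := by
  have hd : IsDensity (zeroPair n) := by
    constructor
    · have : zeroPair n = (zeroPair n)ᴴ * zeroPair n := by simp [zeroPair]
      rw [this]
      exact Matrix.posSemidef_conjTranspose_mul_self _
    · simp [zeroPair]
  have hcont : ∀ x y, Continuous fun U : UGroup n => doubled U (zeroPair n) x y := by
    intro x y
    have hk : Continuous fun U : UGroup n => (U : Op n) ⊗ₖ (U : Op n) := by
      refine continuous_matrix fun i j => ?_
      exact (continuous_coe_apply _ _).mul (continuous_coe_apply _ _)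
    exact ((hk.matrix_mul continuous_const).matrix_mul hk.matrix_conjTranspose).matrix_elem x y
  have key : ∀ (ν : Measure (UGroup n)) [IsProbabilityMeasure ν],
      ((∫ U, overlap W U ∂ν : ℝ) : ℂ) = ∑ a, ∑ b, ∑ c, ∑ d, W a b * star (W c d) *
        ∫ U : UGroup n, doubled U (zeroPair n) (b, c) (a, d) ∂ν := by
    intro ν _
    rw [← integral_complex_ofReal]
    simp_rw [overlap_eq]
    have hi : ∀ a b c d, Integrable (fun U : UGroup n => W a b * star (W c d) *
        doubled U (zeroPair n) (b, c) (a, d)) ν :=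
      fun a b c d => (integrable_of_continuous ν (hcont _ _)).const_mul _
    rw [integral_finsetSum _ fun a _ => integrable_finsetSum _ fun b _ =>
      integrable_finsetSum _ fun c _ => integrable_finsetSum _ fun d _ => hi a b c d]
    refine Finset.sum_congr rfl fun a _ => ?_
    rw [integral_finsetSum _ fun b _ =>
      integrable_finsetSum _ fun c _ => integrable_finsetSum _ fun d _ => hi a b c d]
    refine Finset.sum_congr rfl fun b _ => ?_
    rw [integral_finsetSum _ fun c _ => integrable_finsetSum _ fun d _ => hi a b c d]
    refine Finset.sum_congr rfl fun c _ => ?_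
    rw [integral_finsetSum _ fun d _ => hi a b c d]
    exact Finset.sum_congr rfl fun d _ => integral_const_mul _ _
  apply Complex.ofReal_injective
  rw [key 𝒰, key 𝒰']
  simp_rw [h _ hd]

/-- Right invariance under local unitaries lets `|0⟩` be replaced by random stabilizer product
states in the average overlap. -/
theorem integral_overlap_eq_avg {n : ℕ} {𝒰 : Measure (UGroup n)} (h : LocallyScrambled 𝒰)
    (W : Op n) : ∫ U, overlap W U ∂𝒰 =
      ∫ U : UGroup n, (6 ^ n)⁻¹ * ∑ u, ‖productExp ((U : Op n)ᴴ * W * (U : Op n)) u‖ ^ 2 ∂𝒰 := by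
  have := h.isProbabilityMeasure
  have hu : ∀ u : Fin n → Fin 6, ∃ t : UGroup n, 𝒰.map (fun U => U * t) = 𝒰 ∧
      ∀ U : UGroup n, overlap W (U * t) =
        ‖productExp ((U : Op n)ᴴ * W * (U : Op n)) u‖ ^ 2 := by
    intro u
    refine ⟨tensorUnitary fun i => ⟨stab (u i), stab_mem _⟩, h.map_mul_tensor _, fun U => ?_⟩
    rw [overlap, productExp]
    congr 3
    simp only [Submonoid.coe_mul, Matrix.conjTranspose_mul, tensorUnitary, mul_assoc]
    rfl
  choose t ht1 ht2 using hu
  have hcont : ∀ u, Continuous fun U : UGroup n => U * t u := fun u => continuous_mul_const _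
  have hint : ∀ u, ∫ U, overlap W U ∂𝒰 = ∫ U, overlap W (U * t u) ∂𝒰 := by
    intro u
    conv_lhs => rw [← ht1 u]
    exact integral_map (hcont u).measurable.aemeasurable
      (continuous_overlap W).measurable.aestronglyMeasurable
  simp_rw [← ht2]
  have hi : ∀ u ∈ (Finset.univ : Finset (Fin n → Fin 6)),
      Integrable (fun U => overlap W (U * t u)) 𝒰 :=
    fun u _ => integrable_of_continuous 𝒰 ((continuous_overlap W).comp (hcont u))
  rw [integral_const_mul, integral_finsetSum _ hi]
  simp_rw [← hint]
  simp

/-- The infidelity `1 - |Tr W|² / 4ⁿ` of the unitary `W` with the identity. -/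
def infidelity {n : ℕ} (W : Op n) : ℝ := 1 - ‖W.trace‖ ^ 2 / 4 ^ n

/-- Conjugation by `U` preserves `Tr W`, so the bounds for product states hold for each `U`. -/
theorem integral_overlap_mem {n : ℕ} {𝒰 : Measure (UGroup n)} (h : LocallyScrambled 𝒰)
    (W : UGroup n) : 1 - infidelity (W : Op n) ≤ ∫ U, overlap W U ∂𝒰 ∧
      ∫ U, overlap W U ∂𝒰 ≤ 1 - 2 / 3 * infidelity (W : Op n) := by
  have := h.isProbabilityMeasure
  rw [integral_overlap_eq_avg h]
  have hW : ∀ U : UGroup n, ((U : Op n)ᴴ * (W : Op n) * (U : Op n))ᴴ *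
      ((U : Op n)ᴴ * (W : Op n) * (U : Op n)) = 1 :=
    fun U => conjTranspose_mul_self (U⁻¹ * W * U)
  have htr : ∀ U : UGroup n, ((U : Op n)ᴴ * (W : Op n) * (U : Op n)).trace = (W : Op n).trace := by
    intro U
    rw [Matrix.trace_mul_comm, ← mul_assoc]
    have : (U : Op n) * (U : Op n)ᴴ = 1 := Matrix.mem_unitaryGroup_iff.1 U.2
    rw [this, one_mul]
  have hb := fun U : UGroup n => avg_productExp_mem (hW U)
  simp_rw [htr] at hb
  have hint : Integrable (fun U : UGroup n =>
      (6 ^ n)⁻¹ * ∑ u, ‖productExp ((U : Op n)ᴴ * (W : Op n) * (U : Op n)) u‖ ^ 2) 𝒰 := by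
    refine integrable_of_continuous 𝒰 ?_
    refine continuous_const.mul (continuous_finsetSum _ fun u _ => ?_)
    have h1 : Continuous fun U : UGroup n => ((U : Op n)ᴴ * (W : Op n) * (U : Op n)) :=
      ((continuous_subtype_val.matrix_conjTranspose).matrix_mul continuous_const).matrix_mul
        continuous_subtype_val
    exact ((((continuous_const.matrix_mul h1).matrix_mul
      continuous_const).matrix_elem 0 0).norm).pow 2
  constructor
  · have := integral_mono (integrable_const (‖(W : Op n).trace‖ ^ 2 / 4 ^ n)) hint
      fun U => (hb U).1
    simpa [infidelity] using this
  · have := integral_mono hint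
      (integrable_const (1 / 3 + 2 / 3 * (‖(W : Op n).trace‖ ^ 2 / 4 ^ n))) fun U => (hb U).2
    rw [integral_const, probReal_univ, one_smul] at this
    rw [infidelity]
    linarith

theorem mulVec_zeroKet {n : ℕ} (U : Op n) : U *ᵥ zeroKet n = fun x => U x 0 := by
  ext x
  simp [zeroKet, Matrix.mulVec_single]

theorem continuous_mulVec_zeroKet (n : ℕ) :
    Continuous fun U : UGroup n => (U : Op n) *ᵥ zeroKet n := by
  simp_rw [mulVec_zeroKet]
  exact continuous_pi fun x => continuous_coe_apply x 0

theorem star_dotProduct_mulVec_zeroKet {n : ℕ} (U : UGroup n) (W : Op n) :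
    star ((U : Op n) *ᵥ zeroKet n) ⬝ᵥ (W *ᵥ ((U : Op n) *ᵥ zeroKet n)) =
      ((U : Op n)ᴴ * W * (U : Op n)) 0 0 := by
  rw [Matrix.mulVec_mulVec, star_mulVec_dotProduct_mulVec, mul_assoc, mulVec_zeroKet]
  simp [zeroKet]

theorem star_dotProduct_self_mulVec_zeroKet {n : ℕ} (U : UGroup n) :
    star ((U : Op n) *ᵥ zeroKet n) ⬝ᵥ ((U : Op n) *ᵥ zeroKet n) = 1 := by
  have := star_dotProduct_mulVec_zeroKet U 1
  rw [Matrix.one_mulVec, mul_one, conjTranspose_mul_self] at this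
  simpa using this

theorem isProbabilityMeasure_stateEnsemble {n : ℕ} {𝒰 : Measure (UGroup n)}
    (h : LocallyScrambled₂ 𝒰) : IsProbabilityMeasure (stateEnsemble 𝒰) :=
  have := h.isProbabilityMeasure
  Measure.isProbabilityMeasure_map (continuous_mulVec_zeroKet n).measurable.aemeasurable

theorem LocallyScrambledStates₂.isProbabilityMeasure {n : ℕ} {P : Measure (Ket n)}
    (h : LocallyScrambledStates₂ P) : IsProbabilityMeasure P := by
  obtain ⟨𝒰, h𝒰, rfl⟩ := h
  exact isProbabilityMeasure_stateEnsemble h𝒰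

theorem LocallyScrambledStates₂.ae_normalized {n : ℕ} {P : Measure (Ket n)}
    (h : LocallyScrambledStates₂ P) : ∀ᵐ ψ ∂P, star ψ ⬝ᵥ ψ = 1 := by
  obtain ⟨𝒰, h𝒰, rfl⟩ := h
  have hmeas : MeasurableSet {ψ : Ket n | star ψ ⬝ᵥ ψ = 1} := by
    refine (isClosed_eq ?_ continuous_const).measurableSet
    simp only [dotProduct]
    fun_prop
  rw [stateEnsemble, ae_map_iff (continuous_mulVec_zeroKet n).measurable.aemeasurable hmeas]
  exact Filter.Eventually.of_forall star_dotProduct_self_mulVec_zeroKet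

/-- All locally scrambled risks agree, up to constants, with the infidelity of `U† V` and the
identity. -/
theorem LocallyScrambledStates₂.risk_mem {n : ℕ} {P : Measure (Ket n)}
    (h : LocallyScrambledStates₂ P) (U V : UGroup n) :
    2 / 3 * infidelity ((U : Op n)ᴴ * (V : Op n)) ≤ risk P U V ∧
      risk P U V ≤ infidelity ((U : Op n)ᴴ * (V : Op n)) := by
  obtain ⟨𝒰, h𝒰, rfl⟩ := h
  have := h𝒰.isProbabilityMeasure
  obtain ⟨𝒰', hLS, -, hm⟩ := h𝒰.moments
  have := hLS.isProbabilityMeasure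
  have hrisk : risk (stateEnsemble 𝒰) U V = 1 - ∫ X, overlap ((U : Op n)ᴴ * (V : Op n)) X ∂𝒰 := by
    rw [risk, stateEnsemble, integral_map (continuous_mulVec_zeroKet n).measurable.aemeasurable
      (continuous_loss (conjTranspose_mul_self U)
        (conjTranspose_mul_self V)).measurable.aestronglyMeasurable]
    simp_rw [loss_eq (conjTranspose_mul_self U) (conjTranspose_mul_self V),
      star_dotProduct_self_mulVec_zeroKet, star_dotProduct_mulVec_zeroKet]
    change ∫ X, ((1 : ℂ).re ^ 2 - overlap ((U : Op n)ᴴ * (V : Op n)) X) ∂𝒰 = _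
    rw [integral_sub (integrable_const _) (integrable_of_continuous 𝒰 (continuous_overlap _))]
    simp
  have hb := integral_overlap_mem hLS (U⁻¹ * V)
  rw [← integral_overlap_congr (𝒰 := 𝒰) _ hm] at hb
  have hc : ((U⁻¹ * V : UGroup n) : Op n) = (U : Op n)ᴴ * (V : Op n) := rfl
  rw [hc] at hb
  rw [hrisk]
  constructor <;> linarith [hb.1, hb.2]

/-- Any two locally scrambled ensembles have comparable risks. -/
theorem LocallyScrambledStates₂.risk_le {n : ℕ} {P Q : Measure (Ket n)}
    (hP : LocallyScrambledStates₂ P) (hQ : LocallyScrambledStates₂ Q) (U V : UGroup n) :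
    risk P U V ≤ 3 / 2 * risk Q U V := by
  linarith [(hP.risk_mem U V).2, (hQ.risk_mem U V).1]

section Covering

open scoped Matrix.Norms.L2Operator

/-! ### Operator norm estimates for circuits -/

theorem norm_le_one_of_mem_unitaryGroup {ι : Type*} [Fintype ι] [DecidableEq ι] [Nonempty ι]
    {M : Matrix ι ι ℂ} (hM : M ∈ Matrix.unitaryGroup ι ℂ) : ‖M‖ ≤ 1 :=
  (CStarRing.norm_of_mem_unitary hM).le

theorem norm_single_le {ι : Type*} [Fintype ι] [DecidableEq ι] (a b : ι) (z : ℂ) :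
    ‖Matrix.single a b z‖ ≤ ‖z‖ := by
  have h1 := Matrix.l2_opNorm_conjTranspose_mul_self (Matrix.single a b z)
  have h2 : (Matrix.single a b z)ᴴ * Matrix.single a b z =
      Matrix.diagonal (Pi.single b (star z * z)) := by
    rw [Matrix.conjTranspose_single, Matrix.single_mul_single_same, Matrix.diagonal_single]
  rw [h2, Matrix.l2_opNorm_diagonal, Pi.norm_single, norm_mul, norm_star] at h1
  nlinarith [norm_nonneg z, norm_nonneg (Matrix.single a b z)]

theorem norm_le_sum_norm_apply {ι : Type*} [Fintype ι] [DecidableEq ι] (M : Matrix ι ι ℂ) :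
    ‖M‖ ≤ ∑ a, ∑ b, ‖M a b‖ := by
  conv_lhs => rw [Matrix.matrix_eq_sum_single M]
  exact (norm_sum_le _ _).trans (Finset.sum_le_sum fun a _ =>
    (norm_sum_le _ _).trans (Finset.sum_le_sum fun b _ => norm_single_le a b _))

theorem onWires_eq {n : ℕ} (S : Finset (Fin n)) (G : Matrix (S → Fin 2) (S → Fin 2) ℂ) :
    onWires S G =
      (G ⊗ₖ (1 : Matrix ({i // i ∉ S} → Fin 2) ({i // i ∉ S} → Fin 2) ℂ)).submatrix
        (Equiv.piEquivPiSubtypeProd (fun i => i ∈ S) fun _ => Fin 2)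
        (Equiv.piEquivPiSubtypeProd (fun i => i ∈ S) fun _ => Fin 2) := by
  ext x y
  simp [onWires, Matrix.one_apply, Equiv.piEquivPiSubtypeProd, funext_iff]

/-- `G ↦ G ⊗ 1` as a `*`-homomorphism. -/
def onWiresHom {n : ℕ} (S : Finset (Fin n)) : Matrix (S → Fin 2) (S → Fin 2) ℂ →⋆ₙₐ[ℂ] Op n where
  toFun := onWires S
  map_smul' c G := by
    rw [onWires_eq, onWires_eq, Matrix.smul_kronecker, Matrix.submatrix_smul]
    rfl
  map_zero' := by rw [onWires_eq, Matrix.zero_kronecker, Matrix.submatrix_zero]; rfl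
  map_add' G H := by
    rw [onWires_eq, onWires_eq, onWires_eq, Matrix.add_kronecker, Matrix.submatrix_add]; rfl
  map_mul' G H := by
    rw [onWires_eq, onWires_eq, onWires_eq, Matrix.submatrix_mul_equiv, ← Matrix.mul_kronecker_mul,
      one_mul]
  map_star' G := by
    rw [onWires_eq, onWires_eq, Matrix.star_eq_conjTranspose, Matrix.star_eq_conjTranspose,
      Matrix.conjTranspose_submatrix, Matrix.conjTranspose_kronecker, Matrix.conjTranspose_one]

theorem norm_onWires_sub_le {n : ℕ} (S : Finset (Fin n)) (G H : Matrix (S → Fin 2) (S → Fin 2) ℂ) :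
    ‖onWires S G - onWires S H‖ ≤ ‖G - H‖ := by
  have h : onWires S G - onWires S H = onWiresHom S (G - H) := (map_sub (onWiresHom S) G H).symm
  rw [h]
  exact NonUnitalStarAlgHom.norm_apply_le (onWiresHom S) (G - H)

theorem onWires_mem {n : ℕ} (S : Finset (Fin n)) {G : Matrix (S → Fin 2) (S → Fin 2) ℂ}
    (hG : G ∈ Matrix.unitaryGroup (S → Fin 2) ℂ) :
    onWires S G ∈ Matrix.unitaryGroup (Bits n) ℂ := by
  rw [Matrix.mem_unitaryGroup_iff] at hG ⊢
  have h1 : star (onWires S G) = onWires S (star G) := ((onWiresHom S).map_star' G).symm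
  have h2 : onWires S G * onWires S (star G) = onWires S (G * star G) :=
    ((onWiresHom S).map_mul' G (star G)).symm
  rw [h1, h2, hG, onWires_eq, Matrix.one_kronecker_one, Matrix.submatrix_one_equiv]

/-- Errors of the factors of a product of contractions add up. -/
theorem norm_prod_ofFn_sub_le {R : Type*} [NormedRing R] [NormOneClass R] :
    ∀ {T : ℕ} (a b : Fin T → R), (∀ i, ‖a i‖ ≤ 1) → (∀ i, ‖b i‖ ≤ 1) →
      ‖(List.ofFn a).prod‖ ≤ 1 ∧
        ‖(List.ofFn a).prod - (List.ofFn b).prod‖ ≤ ∑ i, ‖a i - b i‖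
  | 0, a, b, _, _ => by simp
  | T + 1, a, b, ha, hb => by
    obtain ⟨h1, h2⟩ := norm_prod_ofFn_sub_le (fun i => a i.succ) (fun i => b i.succ)
      (fun i => ha _) fun i => hb _
    rw [List.ofFn_succ, List.ofFn_succ, List.prod_cons, List.prod_cons, Fin.sum_univ_succ]
    set x := (List.ofFn fun i => a i.succ).prod
    set y := (List.ofFn fun i => b i.succ).prod
    constructor
    · exact (norm_mul_le _ _).trans (mul_le_one₀ (ha 0) (norm_nonneg _) h1)
    · have h3 : a 0 * x - b 0 * y = (a 0 - b 0) * x + b 0 * (x - y) := by noncomm_ring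
      rw [h3]
      refine (norm_add_le _ _).trans (add_le_add ?_ ?_)
      · exact (norm_mul_le _ _).trans (mul_le_of_le_one_right (norm_nonneg _) h1)
      · exact ((norm_mul_le _ _).trans (mul_le_of_le_one_left (norm_nonneg _) (hb 0))).trans h2

/-- The unitary implemented by a layout whose slots are filled with the gates `g`. -/
def circuit {n k T : ℕ} (L : Layout n k T)
    (g : ∀ i, ↥(Matrix.unitaryGroup (↥(L.wires i) → Fin 2) ℂ)) : Op n :=
  (L.fixed 0 : Op n) *
    (List.ofFn fun i : Fin T => onWires (L.wires i) (g i : Matrix _ _ ℂ) *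
      (L.fixed i.succ : Op n)).prod

theorem circuit_mem {n k T : ℕ} (L : Layout n k T)
    (g : ∀ i, ↥(Matrix.unitaryGroup (↥(L.wires i) → Fin 2) ℂ)) :
    circuit L g ∈ Matrix.unitaryGroup (Bits n) ℂ := by
  refine mul_mem (L.fixed 0).2 (Submonoid.list_prod_mem _ fun M hM => ?_)
  obtain ⟨i, rfl⟩ := List.mem_ofFn.1 hM
  exact mul_mem (onWires_mem _ (g i).2) (L.fixed i.succ).2

theorem norm_circuit_sub_le {n k T : ℕ} (L : Layout n k T)
    (g h : ∀ i, ↥(Matrix.unitaryGroup (↥(L.wires i) → Fin 2) ℂ)) :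
    ‖circuit L g - circuit L h‖ ≤
      ∑ i, ‖(g i : Matrix (↥(L.wires i) → Fin 2) (↥(L.wires i) → Fin 2) ℂ) - h i‖ := by
  have hle : ∀ (g : ∀ i, ↥(Matrix.unitaryGroup (↥(L.wires i) → Fin 2) ℂ)) (i : Fin T),
      ‖onWires (L.wires i) (g i : Matrix _ _ ℂ) * (L.fixed i.succ : Op n)‖ ≤ 1 := fun g i =>
    norm_le_one_of_mem_unitaryGroup (mul_mem (onWires_mem _ (g i).2) (L.fixed i.succ).2)
  rw [circuit, circuit, ← mul_sub]
  refine (norm_mul_le _ _).trans ?_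
  refine (mul_le_of_le_one_left (norm_nonneg _)
    (norm_le_one_of_mem_unitaryGroup (L.fixed 0).2)).trans ?_
  refine (norm_prod_ofFn_sub_le _ _ (hle g) (hle h)).2.trans (Finset.sum_le_sum fun i _ => ?_)
  rw [← sub_mul]
  refine (norm_mul_le _ _).trans ?_
  refine (mul_le_of_le_one_right (norm_nonneg _)
    (norm_le_one_of_mem_unitaryGroup (L.fixed i.succ).2)).trans ?_
  exact norm_onWires_sub_le _ _ _

theorem norm_star_dotProduct_mulVec_le {n : ℕ} (M : Op n) {ψ : Ket n} (hψ : star ψ ⬝ᵥ ψ = 1) :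
    ‖star ψ ⬝ᵥ (M *ᵥ ψ)‖ ≤ ‖M‖ := by
  have hn : ‖WithLp.toLp 2 ψ‖ = 1 := by
    have h1 : ‖WithLp.toLp 2 ψ‖ ^ 2 = 1 := by
      rw [EuclideanSpace.norm_sq_eq]
      have : star ψ ⬝ᵥ ψ = ((∑ i, ‖ψ i‖ ^ 2 : ℝ) : ℂ) := by simp [dotProduct, Complex.conj_mul']
      rw [this] at hψ
      exact_mod_cast hψ
    nlinarith [norm_nonneg (WithLp.toLp 2 ψ)]
  have h1 := norm_inner_le_norm (𝕜 := ℂ) (WithLp.toLp 2 ψ) (WithLp.toLp 2 (M *ᵥ ψ))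
  rw [EuclideanSpace.inner_eq_star_dotProduct, dotProduct_comm, hn, one_mul] at h1
  have h2 := Matrix.l2_opNorm_mulVec M (WithLp.toLp 2 ψ)
  rw [hn, mul_one] at h2
  exact h1.trans h2

theorem abs_sub_sq_sub_le {x y d : ℝ} (s : ℝ) (hx0 : 0 ≤ x) (hx : x ≤ 1) (hy0 : 0 ≤ y)
    (hy : y ≤ 1) (hd : |x - y| ≤ d) : |s - x ^ 2 - (s - y ^ 2)| ≤ 2 * d := by
  have h : s - x ^ 2 - (s - y ^ 2) = -((x + y) * (x - y)) := by ring
  rw [h, abs_neg, abs_mul, abs_of_nonneg (by positivity : 0 ≤ x + y)]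
  exact mul_le_mul (by linarith) hd (abs_nonneg _) (by norm_num)

theorem abs_loss_sub_le {n : ℕ} (U V W : UGroup n) {ψ : Ket n} (hψ : star ψ ⬝ᵥ ψ = 1) :
    |loss (U : Op n) V ψ - loss (U : Op n) W ψ| ≤ 2 * ‖(V : Op n) - W‖ := by
  have h1 : ∀ X : UGroup n, ‖star ψ ⬝ᵥ (((U : Op n)ᴴ * (X : Op n)) *ᵥ ψ)‖ ≤ 1 := fun X =>
    (norm_star_dotProduct_mulVec_le _ hψ).trans
      (norm_le_one_of_mem_unitaryGroup (U⁻¹ * X : UGroup n).2)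
  have h2 : ‖star ψ ⬝ᵥ (((U : Op n)ᴴ * (V : Op n)) *ᵥ ψ) -
      star ψ ⬝ᵥ (((U : Op n)ᴴ * (W : Op n)) *ᵥ ψ)‖ ≤ ‖(V : Op n) - W‖ := by
    rw [← dotProduct_sub, ← Matrix.sub_mulVec, ← mul_sub]
    refine (norm_star_dotProduct_mulVec_le _ hψ).trans ((norm_mul_le _ _).trans ?_)
    exact mul_le_of_le_one_left (norm_nonneg _) (norm_le_one_of_mem_unitaryGroup (U⁻¹).2)
  rw [loss_eq (conjTranspose_mul_self U) (conjTranspose_mul_self V),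
    loss_eq (conjTranspose_mul_self U) (conjTranspose_mul_self W)]
  exact abs_sub_sq_sub_le _ (norm_nonneg _) (h1 V) (norm_nonneg _) (h1 W)
    ((abs_norm_sub_norm_le _ _).trans h2)

/-! ### A finite encoding of the circuits -/

/-- The index of the cell of width `1 / m` of `[-1, 1]` that contains `x`. -/
def gridIndex (m : ℕ) (x : ℝ) : Fin (2 * m + 1) := Fin.ofNat _ ⌊(x + 1) * m⌋₊

theorem abs_sub_le_of_gridIndex_eq {m : ℕ} (hm : 0 < m) {x y : ℝ} (hx : |x| ≤ 1) (hy : |y| ≤ 1)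
    (h : gridIndex m x = gridIndex m y) : |x - y| ≤ 1 / m := by
  have hm' : (0 : ℝ) < m := by exact_mod_cast hm
  have hlt : ∀ z : ℝ, |z| ≤ 1 → ⌊(z + 1) * m⌋₊ < 2 * m + 1 := by
    intro z hz
    rw [Nat.lt_succ_iff]
    refine Nat.floor_le_of_le ?_
    push_cast
    nlinarith [(abs_le.1 hz).2]
  have hnn : ∀ z : ℝ, |z| ≤ 1 → 0 ≤ (z + 1) * m := fun z hz =>
    mul_nonneg (by linarith [(abs_le.1 hz).1]) hm'.le
  have hf : ⌊(x + 1) * m⌋₊ = ⌊(y + 1) * m⌋₊ := by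
    have := congrArg Fin.val h
    simp only [gridIndex, Fin.val_ofNat] at this
    rwa [Nat.mod_eq_of_lt (hlt x hx), Nat.mod_eq_of_lt (hlt y hy)] at this
  have h1 := Nat.floor_le (hnn x hx)
  have h2 := Nat.lt_floor_add_one ((x + 1) * m)
  have h3 := Nat.floor_le (hnn y hy)
  have h4 := Nat.lt_floor_add_one ((y + 1) * m)
  rw [hf] at h1 h2
  rw [le_div_iff₀ hm', ← abs_of_pos hm', ← abs_mul, abs_le]
  constructor <;> linarith

theorem norm_sub_le_of_gridIndex_eq {m : ℕ} (hm : 0 < m) {z w : ℂ} (hz : ‖z‖ ≤ 1) (hw : ‖w‖ ≤ 1)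
    (hre : gridIndex m z.re = gridIndex m w.re) (him : gridIndex m z.im = gridIndex m w.im) :
    ‖z - w‖ ≤ 2 / m := by
  have h1 := abs_sub_le_of_gridIndex_eq hm ((Complex.abs_re_le_norm z).trans hz)
    ((Complex.abs_re_le_norm w).trans hw) hre
  have h2 := abs_sub_le_of_gridIndex_eq hm ((Complex.abs_im_le_norm z).trans hz)
    ((Complex.abs_im_le_norm w).trans hw) him
  calc ‖z - w‖ ≤ |(z - w).re| + |(z - w).im| := Complex.norm_le_abs_re_add_abs_im _
    _ ≤ 1 / m + 1 / m := add_le_add (by simpa using h1) (by simpa using h2)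
    _ = 2 / m := by ring

/-- Gate entries rounded to the grid of width `1 / m`; their type depends on the layout. -/
abbrev GateCode {n k T : ℕ} (m : ℕ) (L : Layout n k T) : Type :=
  ∀ i : Fin T, (↥(L.wires i) → Fin 2) → (↥(L.wires i) → Fin 2) →
    Fin (2 * m + 1) × Fin (2 * m + 1)

/-- Rounds all entries of all gates. -/
def gateCode {n k T : ℕ} (m : ℕ) (L : Layout n k T)
    (g : ∀ i, ↥(Matrix.unitaryGroup (↥(L.wires i) → Fin 2) ℂ)) : GateCode m L :=
  fun i a b => (gridIndex m ((g i : Matrix _ _ ℂ) a b).re,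
    gridIndex m ((g i : Matrix _ _ ℂ) a b).im)

theorem norm_circuit_sub_le_of_gateCode_eq {n k T m : ℕ} (hm : 0 < m) {L : Layout n k T}
    {g h : ∀ i, ↥(Matrix.unitaryGroup (↥(L.wires i) → Fin 2) ℂ)}
    (hgh : gateCode m L g = gateCode m L h) :
    ‖circuit L g - circuit L h‖ ≤ T * (4 ^ k * (2 / m)) := by
  refine (norm_circuit_sub_le L g h).trans ?_
  calc _ ≤ ∑ _i : Fin T, (4 ^ k * (2 / m) : ℝ) := Finset.sum_le_sum fun i _ => ?_
    _ = T * (4 ^ k * (2 / m)) := by simp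
  refine (norm_le_sum_norm_apply _).trans ?_
  have hent : ∀ a b, ‖((g i : Matrix (↥(L.wires i) → Fin 2) (↥(L.wires i) → Fin 2) ℂ) - h i) a b‖ ≤
      2 / m := by
    intro a b
    have hab := congrFun (congrFun (congrFun hgh i) a) b
    rw [Matrix.sub_apply]
    exact norm_sub_le_of_gridIndex_eq hm (entry_norm_bound_of_unitary (g i).2 a b)
      (entry_norm_bound_of_unitary (h i).2 a b) (congrArg Prod.fst hab) (congrArg Prod.snd hab)
  calc _ ≤ ∑ _a : ↥(L.wires i) → Fin 2, ∑ _b : ↥(L.wires i) → Fin 2, (2 / m : ℝ) :=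
        Finset.sum_le_sum fun a _ => Finset.sum_le_sum fun b _ => hent a b
    _ = (4 : ℝ) ^ (L.wires i).card * (2 / m) := by
        have h4 : (4 : ℝ) ^ (L.wires i).card = 2 ^ (L.wires i).card * 2 ^ (L.wires i).card := by
          rw [← mul_pow]; norm_num
        simp [h4]
        ring
    _ ≤ 4 ^ k * (2 / m) := by
        gcongr
        · norm_num
        · exact L.card_wires_le i

theorem card_gateCode_le {n k T : ℕ} (m : ℕ) (L : Layout n k T) :
    Nat.card (GateCode m L) ≤ (2 * m + 1) ^ (2 * 4 ^ k * T) := by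
  rw [Nat.card_pi]
  calc _ ≤ ∏ _i : Fin T, (2 * m + 1) ^ (2 * 4 ^ k) := Finset.prod_le_prod' fun i _ => ?_
    _ = (2 * m + 1) ^ (2 * 4 ^ k * T) := by simp [← pow_mul]
  rw [Nat.card_fun, Nat.card_fun]
  simp only [Nat.card_eq_fintype_card, Fintype.card_prod, Fintype.card_fin, Fintype.card_pi,
    Finset.prod_const, Finset.card_univ, Fintype.card_coe]
  rw [← sq, ← pow_mul, ← pow_mul, ← mul_pow]
  refine Nat.pow_le_pow_right (by omega) ?_
  refine Nat.mul_le_mul_left 2 ?_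
  exact Nat.pow_le_pow_right (by norm_num) (L.card_wires_le i)

theorem QNN.V_mem {n k T : ℕ} {A : Type*} (q : QNN n k T A) (α : A) :
    q.V α ∈ Matrix.unitaryGroup (Bits n) ℂ := circuit_mem _ _

theorem norm_circuit_sub_le_of_heq {n k T m : ℕ} (hm : 0 < m) {L L' : Layout n k T} (hL : L = L')
    {g : ∀ i, ↥(Matrix.unitaryGroup (↥(L.wires i) → Fin 2) ℂ)}
    {g' : ∀ i, ↥(Matrix.unitaryGroup (↥(L'.wires i) → Fin 2) ℂ)}
    (h : HEq (gateCode m L g) (gateCode m L' g')) :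
    ‖circuit L g - circuit L' g'‖ ≤ T * (4 ^ k * (2 / m)) := by
  subst hL
  exact norm_circuit_sub_le_of_gateCode_eq hm (eq_of_heq h)

/-- The circuits of a QNN fall into finitely many classes, within which the loss varies by at most
`4 ^ (k + 1) T / m`. -/
theorem QNN.exists_finite_code {n k T : ℕ} {A : Type*} (q : QNN n k T A) {K : ℕ}
    (hK : q.numStructures ≤ (K : ℕ∞)) {m : ℕ} (hm : 0 < m) (U : UGroup n) :
    ∃ (F : Type) (_ : Fintype F) (code : A → F),
      Fintype.card F ≤ K * (2 * m + 1) ^ (2 * 4 ^ k * T) ∧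
      ∀ α β, code α = code β → ∀ ψ : Ket n, star ψ ⬝ᵥ ψ = 1 →
        |loss (U : Op n) (q.V α) ψ - loss (U : Op n) (q.V β) ψ| ≤ 4 ^ (k + 1) * T / m := by
  have hfin : (Set.range q.layout).Finite :=
    Set.finite_of_encard_le_coe hK
  have hcard : (Set.range q.layout).ncard ≤ K := by
    have : ((Set.range q.layout).ncard : ℕ∞) ≤ K := by
      rw [hfin.cast_ncard_eq]
      exact hK
    exact_mod_cast this
  have : Fintype (Set.range q.layout) := hfin.fintype
  classical
  refine ⟨Σ L : Set.range q.layout, GateCode m L.1, inferInstance,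
    fun α => ⟨⟨q.layout α, Set.mem_range_self α⟩, gateCode m _ (q.gate α)⟩, ?_, ?_⟩
  · rw [Fintype.card_sigma]
    calc _ ≤ ∑ _L : Set.range q.layout, (2 * m + 1) ^ (2 * 4 ^ k * T) :=
          Finset.sum_le_sum fun L _ => by
            rw [← Nat.card_eq_fintype_card]
            exact card_gateCode_le m L.1
      _ = (Set.range q.layout).ncard * (2 * m + 1) ^ (2 * 4 ^ k * T) := by
          rw [Finset.sum_const, smul_eq_mul, Finset.card_univ, ← Nat.card_eq_fintype_card]
          rfl
      _ ≤ _ := Nat.mul_le_mul_right _ hcard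
  · intro α β hαβ ψ hψ
    obtain ⟨h1, h2⟩ := Sigma.mk.inj_iff.1 hαβ
    have hn := norm_circuit_sub_le_of_heq (g := q.gate α) (g' := q.gate β) hm
      (congrArg Subtype.val h1) h2
    refine (abs_loss_sub_le U ⟨q.V α, q.V_mem α⟩ ⟨q.V β, q.V_mem β⟩ hψ).trans ?_
    calc _ ≤ 2 * (T * (4 ^ k * (2 / m)) : ℝ) := by
          gcongr
          exact hn
      _ = 4 ^ (k + 1) * T / m := by ring

end Covering

/-! ### A one-sided multiplicative Chernoff bound -/

/-- The slack `(1 / 2) / (3 / 8) = 4 / 3` is what the comparison factor `3 / 2` of two risks leaves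
of the total factor `2`. -/
theorem exp_neg_half_le {x : ℝ} (h0 : 0 ≤ x) (h1 : x ≤ 1) :
    Real.exp (-(x / 2)) ≤ 1 - 3 / 8 * x := by
  have hc := convexOn_exp.2 (Set.mem_univ (0 : ℝ)) (Set.mem_univ (-(1 / 2) : ℝ))
    (sub_nonneg.2 h1) h0 (by ring)
  simp only [smul_eq_mul, mul_zero, Real.exp_zero, zero_add, mul_one] at hc
  have he : Real.exp (-(1 / 2)) ≤ 5 / 8 := by
    rw [Real.exp_neg, inv_le_comm₀ (Real.exp_pos _) (by norm_num)]
    have := Real.quadratic_le_exp_of_nonneg (x := 1 / 2) (by norm_num)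
    linarith
  have hx : x * -(1 / 2) = -(x / 2) := by ring
  rw [hx] at hc
  nlinarith

/-- The empirical mean of independent copies of a `[0, 1]`-valued variable is at least `3 / 4` of
the true mean up to an additive error `2 t / N`, with probability at least `1 - exp (-t)`. The
multiplicative slack is what makes the error of order `1 / N`. -/
theorem measureReal_pi_chernoff {X : Type*} [MeasurableSpace X] (Q : Measure X)
    [IsProbabilityMeasure Q] {f : X → ℝ} (hf : Measurable f)
    (h01 : ∀ᵐ x ∂Q, 0 ≤ f x ∧ f x ≤ 1) (N : ℕ) (t : ℝ) :
    (Measure.pi fun _ : Fin N => Q).real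
      {D | t ≤ 3 / 8 * (N * ∫ x, f x ∂Q) - 1 / 2 * ∑ j, f (D j)} ≤ Real.exp (-t) := by
  set I := ∫ x, f x ∂Q with hI
  have hfint : Integrable f Q := Integrable.of_bound hf.aestronglyMeasurable 1 (by
    filter_upwards [h01] with x hx
    rw [Real.norm_eq_abs, abs_of_nonneg hx.1]
    exact hx.2)
  have hgint : Integrable (fun x => Real.exp (-(f x / 2))) Q :=
    Integrable.of_bound (by fun_prop) 1 (by
      filter_upwards [h01] with x hx
      rw [Real.norm_eq_abs, Real.abs_exp, Real.exp_le_one_iff]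
      linarith [hx.1])
  have hexp : ∫ x, Real.exp (-(f x / 2)) ∂Q ≤ Real.exp (-(3 / 8 * I)) := by
    calc ∫ x, Real.exp (-(f x / 2)) ∂Q ≤ ∫ x, (1 - 3 / 8 * f x) ∂Q :=
          integral_mono_ae hgint ((integrable_const 1).sub (hfint.const_mul _)) (by
            filter_upwards [h01] with x hx
            exact exp_neg_half_le hx.1 hx.2)
      _ = 1 - 3 / 8 * I := by
          rw [integral_sub (integrable_const _) (hfint.const_mul _), integral_const_mul]
          simp [hI]
      _ ≤ Real.exp (-(3 / 8 * I)) := by linarith [Real.add_one_le_exp (-(3 / 8 * I))]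
  have hmarkov := mul_meas_ge_le_integral_of_nonneg (μ := Measure.pi fun _ : Fin N => Q)
    (f := fun D => ∏ j, Real.exp (-(f (D j) / 2)))
    (Filter.Eventually.of_forall fun D => Finset.prod_nonneg fun j _ => (Real.exp_pos _).le)
    (Integrable.fintype_prod fun _ => hgint) (Real.exp (t - 3 / 8 * (N * I)))
  have hint : ∫ D, ∏ j : Fin N, Real.exp (-(f (D j) / 2)) ∂(Measure.pi fun _ : Fin N => Q) =
      (∫ x, Real.exp (-(f x / 2)) ∂Q) ^ N := by
    have := integral_fintype_prod_eq_pow (ι := Fin N) (μ := Q) fun x => Real.exp (-(f x / 2))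
    simpa using this
  rw [hint] at hmarkov
  have hset : {D : Fin N → X | t ≤ 3 / 8 * (N * I) - 1 / 2 * ∑ j, f (D j)} =
      {D | Real.exp (t - 3 / 8 * (N * I)) ≤ ∏ j, Real.exp (-(f (D j) / 2))} := by
    ext D
    rw [Set.mem_ofPred_eq, Set.mem_ofPred_eq, ← Real.exp_sum, Real.exp_le_exp,
      Finset.sum_neg_distrib, ← Finset.sum_div]
    constructor <;> intro h <;> linarith
  rw [hset]
  have hpow : (∫ x, Real.exp (-(f x / 2)) ∂Q) ^ N ≤
      Real.exp (t - 3 / 8 * (N * I)) * Real.exp (-t) := by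
    calc _ ≤ (Real.exp (-(3 / 8 * I))) ^ N := by
          gcongr
      _ = Real.exp (t - 3 / 8 * (N * I)) * Real.exp (-t) := by
          rw [← Real.exp_nat_mul, ← Real.exp_add]
          congr 1
          ring
  exact le_of_mul_le_mul_left (hmarkov.trans hpow) (Real.exp_pos _)

theorem ofReal_one_sub_le_measure {X : Type*} [MeasurableSpace X] {μ : Measure X}
    [IsProbabilityMeasure μ] {s : Set X} {δ : ℝ} (hδ : 0 ≤ δ) (h : μ sᶜ ≤ ENNReal.ofReal δ) :
    ENNReal.ofReal (1 - δ) ≤ μ s := by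
  rw [ENNReal.ofReal_sub _ hδ, ENNReal.ofReal_one, tsub_le_iff_right, ← measure_univ (μ := μ),
    ← Set.union_compl_self s]
  exact (measure_union_le _ _).trans (by gcongr)

/-! ### Generalization bounds -/

theorem trainingCost_nonneg {n N : ℕ} (D : Fin N → Ket n) (U V : Op n) :
    0 ≤ trainingCost D U V := by
  unfold trainingCost
  exact mul_nonneg (by positivity) (Finset.sum_nonneg fun j _ => loss_nonneg U V _)

theorem integrable_loss {n : ℕ} {Q : Measure (Ket n)} (hQ : LocallyScrambledStates₂ Q)
    {U V : Op n} (hU : Uᴴ * U = 1) (hV : Vᴴ * V = 1) : Integrable (loss U V) Q := by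
  have := hQ.isProbabilityMeasure
  refine Integrable.of_bound (continuous_loss hU hV).measurable.aestronglyMeasurable 1 ?_
  filter_upwards [hQ.ae_normalized] with ψ hψ
  rw [Real.norm_eq_abs, abs_of_nonneg (loss_nonneg U V ψ)]
  exact loss_le_one hU hV hψ

/-- A generalization bound for a family of unitaries that falls into at most `M` classes, within
which the loss varies by at most `η`: a union bound over one representative of each class. -/
theorem measure_pi_risk_le_of_code {n : ℕ} {Q : Measure (Ket n)} (hQ : LocallyScrambledStates₂ Q)
    (U : UGroup n) {A : Type*} (V : A → UGroup n) {F : Type*} [Fintype F] (code : A → F) {η : ℝ}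
    (hη : ∀ α β, code α = code β → ∀ ψ : Ket n, star ψ ⬝ᵥ ψ = 1 →
      |loss (U : Op n) (V α) ψ - loss (U : Op n) (V β) ψ| ≤ η)
    {M : ℝ} (hM : 0 < M) (hF : Fintype.card F ≤ M) {N : ℕ} (hN : 0 < N) {δ : ℝ} (hδ : 0 < δ) :
    ENNReal.ofReal (1 - δ) ≤ (Measure.pi fun _ : Fin N => Q) {D | ∀ α,
      risk Q U (V α) ≤ 4 / 3 * trainingCost D U (V α) + 7 / 3 * η +
        8 / 3 * ((Real.log M + Real.log (1 / δ)) / N)} := by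
  have := hQ.isProbabilityMeasure
  have hN' : (0 : ℝ) < N := by exact_mod_cast hN
  have hU := conjTranspose_mul_self U
  set t := Real.log M + Real.log (1 / δ) with ht
  -- `t` is chosen so that the failure probabilities of `M` classes add up to `δ`.
  have het : Real.exp (-t) = δ / M := by
    rw [ht, neg_add, Real.exp_add, ← Real.log_inv, ← Real.log_inv, Real.exp_log (by positivity),
      Real.exp_log (by positivity)]
    field_simp
  apply ofReal_one_sub_le_measure hδ.le
  -- The samples that are atypical for the chosen representative of the class `f`.
  let bad (f : F) : Set (Fin N → Ket n) :=
    {D | ∃ h : ∃ α, code α = f, t ≤ 3 / 8 * (N * ∫ ψ, loss (U : Op n) (V h.choose) ψ ∂Q) -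
      1 / 2 * ∑ j, loss (U : Op n) (V h.choose) (D j)}
  have hbad : ∀ f, (Measure.pi fun _ : Fin N => Q) (bad f) ≤ ENNReal.ofReal (δ / M) := by
    intro f
    by_cases h : ∃ α, code α = f
    · have h1 := measureReal_pi_chernoff Q
        (continuous_loss hU (conjTranspose_mul_self (V h.choose))).measurable (by
          filter_upwards [hQ.ae_normalized] with ψ hψ
          exact ⟨loss_nonneg _ _ _, loss_le_one hU (conjTranspose_mul_self _) hψ⟩) N t
      rw [het] at h1
      have h2 : bad f = {D | t ≤ 3 / 8 * (N * ∫ ψ, loss (U : Op n) (V h.choose) ψ ∂Q) -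
          1 / 2 * ∑ j, loss (U : Op n) (V h.choose) (D j)} := by
        ext D
        simp [bad, h]
      rw [h2, ENNReal.le_ofReal_iff_toReal_le (measure_ne_top _ _) (by positivity)]
      exact h1
    · have : bad f = ∅ := by
        ext D
        simp [bad, h]
      rw [this, measure_empty]
      exact zero_le
  have hnorm : ∀ᵐ D ∂(Measure.pi fun _ : Fin N => Q), ∀ j, star (D j) ⬝ᵥ (D j) = 1 := by
    rw [ae_all_iff]
    intro j
    exact (measurePreserving_eval (fun _ : Fin N => Q) j).quasiMeasurePreserving.ae
      hQ.ae_normalized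
  calc _ ≤ (Measure.pi fun _ : Fin N => Q) (⋃ f, bad f) := measure_mono_ae ?_
    _ ≤ ∑ f, (Measure.pi fun _ : Fin N => Q) (bad f) := measure_iUnion_fintype_le _ _
    _ ≤ ∑ _f : F, ENNReal.ofReal (δ / M) := Finset.sum_le_sum fun f _ => hbad f
    _ = ENNReal.ofReal (Fintype.card F * (δ / M)) := by
        rw [ENNReal.ofReal_mul (Nat.cast_nonneg _), ENNReal.ofReal_natCast, Finset.sum_const,
          nsmul_eq_mul, Finset.card_univ]
    _ ≤ ENNReal.ofReal δ := by
        apply ENNReal.ofReal_le_ofReal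
        rw [mul_div_left_comm]
        exact mul_le_of_le_one_right hδ.le ((div_le_one hM).2 hF)
  -- For every other sample, the bound passes from the representative to the whole class.
  filter_upwards [hnorm] with D hD hDc
  change D ∈ ⋃ f, bad f
  by_contra hgood
  refine hDc ?_
  change ∀ α, _
  intro α
  rw [Set.mem_iUnion, not_exists] at hgood
  have hex : ∃ β, code β = code α := ⟨α, rfl⟩
  have hg := hgood (code α)
  simp only [bad, Set.mem_ofPred_eq, not_exists, not_le] at hg
  have h1 := hg hex
  set β := hex.choose with hβ
  have hηβ := hη α β hex.choose_spec.symm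
  have hVα := conjTranspose_mul_self (V α)
  have hVβ := conjTranspose_mul_self (V β)
  have h2 : risk Q U (V α) ≤ ∫ ψ, loss (U : Op n) (V β) ψ ∂Q + η := by
    calc risk Q U (V α) ≤ ∫ ψ, (loss (U : Op n) (V β) ψ + η) ∂Q :=
          integral_mono_ae (integrable_loss hQ hU hVα)
            ((integrable_loss hQ hU hVβ).add (integrable_const _)) (by
              filter_upwards [hQ.ae_normalized] with ψ hψ
              linarith [(abs_le.1 (hηβ ψ hψ)).2])
      _ = _ := by
          rw [integral_add (integrable_loss hQ hU hVβ) (integrable_const _)]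
          simp
  have h3 : ∑ j, loss (U : Op n) (V β) (D j) ≤ ∑ j, loss (U : Op n) (V α) (D j) + N * η := by
    calc _ ≤ ∑ j, (loss (U : Op n) (V α) (D j) + η) := Finset.sum_le_sum fun j _ => by
          linarith [(abs_le.1 (hηβ _ (hD j))).1]
      _ = _ := by simp [Finset.sum_add_distrib]
  have h4 : ∑ j, loss (U : Op n) (V α) (D j) = N * trainingCost D U (V α) := by
    rw [trainingCost]
    field_simp
  have h5 : t = N * (t / N) := by field_simp
  rw [h4] at h3
  rw [h5] at h1
  have h6 : (N : ℝ) * (3 / 8 * ∫ ψ, loss (U : Op n) (V β) ψ ∂Q) <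
      N * (1 / 2 * trainingCost D U (V α) + 1 / 2 * η + t / N) := by linarith
  have h7 := lt_of_mul_lt_mul_left h6 hN'.le
  linarith

/-- For the grid width `1 / (T N)`, the logarithm of the number of circuit classes divided by `N`,
and the discretization error, are of order `√(T log T / N)` when the latter is at most one. The
logarithm of `N` is absorbed by `- x log x ≤ 2 √x` for `x = T log T / N`, as `T log (T N) / N` is at
most of order `x + x log (1 / x) / log T`. -/
theorem complexity_le (k κ : ℕ) {T N : ℕ} (hT : 2 ≤ T) (hN : 1 ≤ N)
    (hx : T * Real.log T / N ≤ 1) :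
    7 / 2 * (4 ^ (k + 1) * T / (T * N : ℕ) : ℝ) + 4 * (Real.log ((T ^ (κ * T) *
      (2 * (T * N) + 1) ^ (2 * 4 ^ k * T) : ℕ) : ℝ) / N) ≤
      (4 * κ + 86 * 4 ^ k) * √(T * Real.log T / N) := by
  have hT' : (2 : ℝ) ≤ T := by exact_mod_cast hT
  have hN' : (1 : ℝ) ≤ N := by exact_mod_cast hN
  have hT0 : (0 : ℝ) < T := by linarith
  have hN0 : (0 : ℝ) < N := by linarith
  have hl2 : Real.log 2 ≤ Real.log T := Real.log_le_log (by norm_num) hT'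
  have hl : 1 / 2 ≤ Real.log T := by linarith [Real.log_two_gt_d9]
  have hl0 : 0 < Real.log T := by linarith
  set x := T * Real.log T / N with hxdef
  have hx0 : 0 < x := by positivity
  have hxs : x ≤ √x := by
    rw [Real.le_sqrt hx0.le hx0.le, sq]
    nlinarith
  have hs0 : 0 < √x := Real.sqrt_pos.2 hx0
  have hTx : T / N ≤ 2 * x := by
    rw [hxdef, mul_div_assoc', div_le_div_iff_of_pos_right hN0]
    nlinarith
  have hNx : 1 / N ≤ x := by
    rw [hxdef, div_le_div_iff_of_pos_right hN0]
    nlinarith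
  have hlogN : Real.log N ≤ 2 / √x + 2 * Real.log T := by
    have h1 : (N : ℝ) = x⁻¹ * (T * Real.log T) := by
      rw [hxdef]; field_simp
    have h2 : Real.log x⁻¹ ≤ 2 / √x := by
      have h3 : x⁻¹ = (√x)⁻¹ ^ 2 := by rw [inv_pow, Real.sq_sqrt hx0.le]
      rw [h3, Real.log_pow]
      have := Real.log_le_sub_one_of_pos (inv_pos.2 hs0)
      rw [div_eq_mul_inv]
      push_cast
      linarith
    have h4 : Real.log (Real.log T) ≤ Real.log T :=
      Real.log_le_log hl0 (by linarith [Real.log_le_sub_one_of_pos hT0])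
    rw [h1, Real.log_mul (inv_pos.2 hx0).ne' (by positivity), Real.log_mul hT0.ne' hl0.ne']
    linarith
  have hlog : Real.log (2 * (T * N) + 1) ≤ 3 * Real.log T + Real.log N := by
    have h1 : (2 * (T * N) + 1 : ℝ) ≤ 2 ^ 2 * (T * N) := by nlinarith
    calc _ ≤ Real.log (2 ^ 2 * (T * N)) := Real.log_le_log (by positivity) h1
      _ = 2 * Real.log 2 + (Real.log T + Real.log N) := by
          rw [Real.log_mul (by norm_num) (by positivity), Real.log_mul hT0.ne' hN0.ne',
            Real.log_pow]
          push_cast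
          ring
      _ ≤ _ := by linarith
  have hmain : T / N * Real.log (2 * (T * N) + 1) ≤ 9 * √x := by
    calc _ ≤ T / N * (5 * Real.log T + 2 / √x) := by gcongr; linarith
      _ = 5 * x + T / N * (2 / √x) := by rw [hxdef]; ring
      _ ≤ 5 * x + 2 * x * (2 / √x) := by gcongr
      _ = 5 * x + 4 * √x := by
          have : x * (1 / √x) = √x := by rw [mul_one_div, Real.div_sqrt]
          linear_combination 4 * this
      _ ≤ 9 * √x := by linarith
  have hlogM : Real.log ((T ^ (κ * T) * (2 * (T * N) + 1) ^ (2 * 4 ^ k * T) : ℕ) : ℝ) / N =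
      κ * x + 2 * 4 ^ k * (T / N * Real.log (2 * (T * N) + 1)) := by
    push_cast
    rw [Real.log_mul (by positivity) (by positivity), Real.log_pow, Real.log_pow, hxdef]
    push_cast
    ring
  have hη : (4 ^ (k + 1) * T / (T * N : ℕ) : ℝ) = 4 * 4 ^ k * (1 / N) := by
    push_cast
    field_simp
    ring
  rw [hlogM, hη]
  have hk : (0 : ℝ) < 4 ^ k := by positivity
  have e1 : (4 : ℝ) ^ k * (1 / N) ≤ 4 ^ k * √x := by gcongr; linarith
  have e2 : (κ : ℝ) * x ≤ κ * √x := by gcongr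
  have e3 : (4 : ℝ) ^ k * (T / N * Real.log (2 * (T * N) + 1)) ≤ 4 ^ k * (9 * √x) := by gcongr
  linarith

end

end OOD

theorem corollary2 (k κ : ℕ) :
    ∃ c : ℝ, 0 < c ∧
      ∀ (n T N : ℕ) (_ : 2 ≤ T) (_ : 1 ≤ N) (δ : ℝ) (_ : 0 < δ) (_ : δ < 1)
        (P Q : MeasureTheory.Measure (OOD.Ket n))
        (_ : OOD.LocallyScrambledStates₂ P) (_ : OOD.LocallyScrambledStates₂ Q)
        (U : OOD.UGroup n) (A : Type*) (q : OOD.QNN n k T A)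
        (_ : q.numStructures ≤ ((T ^ (κ * T) : ℕ) : ℕ∞)),
        ENNReal.ofReal (1 - δ) ≤
          (MeasureTheory.Measure.pi fun _ : Fin N => Q)
            {D : Fin N → OOD.Ket n | ∀ α : A,
              OOD.risk P U (q.V α) ≤
                2 * OOD.trainingCost D U (q.V α) +
                  c * (√(T * Real.log T / N) + √(Real.log (1 / δ) / N))} := by
  refine ⟨4 * κ + 86 * 4 ^ k + 4, by positivity, ?_⟩
  intro n T N hT hN δ hδ _ P Q hP hQ U A q hq
  have hk : (0 : ℝ) < 4 ^ k := by positivity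
  have := hQ.isProbabilityMeasure
  let V : A → OOD.UGroup n := fun α => ⟨q.V α, q.V_mem α⟩
  set x := T * Real.log T / N with hx
  set L := Real.log (1 / δ) / N with hL
  have hsx := Real.sqrt_nonneg x
  have hsL := Real.sqrt_nonneg L
  have hκ : (0 : ℝ) ≤ κ := Nat.cast_nonneg κ
  by_cases hsmall : x ≤ 1 ∧ L ≤ 1
  · obtain ⟨hx1, hL1⟩ := hsmall
    have hTN : 0 < T * N := Nat.mul_pos (by omega) (by omega)
    obtain ⟨F, _, code, hcard, hcode⟩ := q.exists_finite_code hq hTN U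
    have hM : 0 < T ^ (κ * T) * (2 * (T * N) + 1) ^ (2 * 4 ^ k * T) := by positivity
    refine (OOD.measure_pi_risk_le_of_code hQ U V code hcode
      (M := ((T ^ (κ * T) * (2 * (T * N) + 1) ^ (2 * 4 ^ k * T) : ℕ) : ℝ)) (by exact_mod_cast hM)
      (by exact_mod_cast hcard) (by omega) hδ).trans (measure_mono fun D hD α => ?_)
    have h1 := hD α
    have h2 := hP.risk_le hQ U (V α)
    have h3 := OOD.complexity_le k κ hT hN hx1
    have hL0 : 0 ≤ L := div_nonneg
      (Real.log_nonneg (by rw [le_div_iff₀ hδ]; linarith)) (Nat.cast_nonneg N)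
    have hLs : L ≤ √L := by
      rw [Real.le_sqrt hL0 hL0, sq]
      nlinarith
    rw [add_div, ← hL] at h1
    rw [← hx] at h3
    change OOD.risk P U (V α) ≤ 2 * OOD.trainingCost D U (V α) + _
    nlinarith [mul_nonneg hκ hsL, mul_nonneg hk.le hsL]
  · -- The right-hand side is at least one.
    have hall : {D : Fin N → OOD.Ket n | ∀ α : A, OOD.risk P U (q.V α) ≤
        2 * OOD.trainingCost D U (q.V α) + (4 * κ + 86 * 4 ^ k + 4) * (√x + √L)} = Set.univ := by
      refine Set.eq_univ_of_forall fun D α => ?_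
      have h1 : 1 ≤ √x + √L := by
        rcases not_and_or.1 hsmall with h | h
        · linarith [Real.one_le_sqrt.2 (not_le.1 h).le]
        · linarith [Real.one_le_sqrt.2 (not_le.1 h).le]
      have h2 : OOD.risk P U (V α) ≤ 1 := (hP.risk_mem U (V α)).2.trans (by
        unfold OOD.infidelity
        linarith [show 0 ≤ ‖((U : OOD.Op n)ᴴ * (V α : OOD.Op n)).trace‖ ^ 2 / 4 ^ n by positivity])
      have h3 := OOD.trainingCost_nonneg D (U : OOD.Op n) (q.V α)
      change OOD.risk P U (V α) ≤ _
      nlinarith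
    rw [hall, measure_univ]
    exact ENNReal.ofReal_le_one.2 (by linarith)
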